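/- **Setting.** A superform on $\mathbb R^n$ is a form $\alpha=\sum\alpha_{IK}(x)\,dx_I\wedge d\xi_K$ on $\mathbb C^n=\{x+i\xi\}$ with real coefficients not depending on $\xi$; it has bidegree $(p,q)$ if only terms with $|I|=p$, $|K|=q$ occur. Let $J$ be the multiplicative map with $J(d\xi_j)=dx_j$, $J(dx_j)=-d\xi_j$, put $\alpha^\#=-J\alpha$ for $\alpha$ of bidegree $(1,0)$, and let $d\alpha=\sum_j dx_j\wedge\partial_{x_j}\alpha$, $d^\#\alpha=\sum_j d\xi_j\wedge\partial_{x_j}\alpha$, so that $dd^\#\psi=\sum\psi_{jk}\,dx_j\wedge d\xi_k$ for a smooth function $\psi$. A $(p,p)$-form $\omega$ is symmetric if $J\omega=\omega$. At a point, an elementary $(p,p)$-form is a product $\alpha_1\wedge\alpha_1^\#\wedge\dots\wedge\alpha_p\wedge\alpha_p^\#$ with $\alpha_j$ of bidegree $(1,0)$; the strongly positive $(p,p)$-forms are the closure of the finite combinations of elementary forms with positive coefficients; a symmetric $(p,p)$-form $\omega$ is weakly positive if $\omega\wedge E$ is a nonnegative multiple of $dx_1\wedge d\xi_1\wedge\dots\wedge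 dx_n\wedge d\xi_n$ for every elementary $(n-p,n-p)$-form $E$, and weakly null if both $\omega$ and $-\omega$ are weakly positive. A supercurrent $\Omega$ of bidegree $(p,q)$ is an element of the dual of the space of smooth compactly supported superforms of bidegree $(n-p,n-q)$ (so $\Omega=0$ if $p>n$ or $q>n$); write $\int\Omega\wedge\chi$ for its value at $\chi$. It is closed if it vanishes on all $d\chi$. A $(p,p)$-supercurrent is symmetric if $\int\Omega\wedge J\chi=\int\Omega\wedge\chi$ for all $\chi$. A symmetric $(p,p)$-supercurrent is weakly positive if $\int\Omega\wedge\chi\ge 0$ for all test forms $\chi$ that are strongly positive at each point, and strong if $\int\Omega\wedge\chi=0$ for all test forms $\chi$ that are weakly null at each point. **Theorem.** Let $n,p,k\ge 0$. There is a map $(\psi_1,\dots,\psi_k,\Omega)\mapsto M(\psi_1,\dots,\psi_k,\Omega)$ with values in the supercurrents on $\mathbb R^n$, defined whenever $\psi_1,\dots,\psi_k:\mathbb R^n\to\mathbb R$ are smooth and $\Omega$ is a $(p,p)$-supercurrent, and also whenever the $\psi_j$ are convex and $\Omega$ is a closed, weakly positive and strong $(p,p)$-supercurrent, such that: 1. If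 the $\psi_j$ are smooth, then $M(\psi_1,\dots,\psi_k,\Omega)=dd^\#\psi_1\wedge\dots\wedge dd^\#\psi_k\wedge\Omega$, that is, $\int M(\psi_1,\dots,\psi_k,\Omega)\wedge\chi=\int\Omega\wedge(dd^\#\psi_1\wedge\dots\wedge dd^\#\psi_k\wedge\chi)$ for all test forms $\chi$. 2. Let $\psi_j^i$ and $\psi_j$ ($i\in\mathbb N$, $1\le j\le k$) be convex, and $\Omega^i$, $\Omega$ closed, weakly positive and strong $(p,p)$-supercurrents. If $\psi_j^i\to\psi_j$ uniformly on compact sets (in particular, if $\psi_j^i\to\psi_j$ uniformly) for each $j$, and $\Omega^i\to\Omega$ weak\*, as $i\to\infty$, then $M(\psi_1^i,\dots,\psi_k^i,\Omega^i)\to M(\psi_1,\dots,\psi_k,\Omega)$ weak\*. 3. If the $\psi_j$ are convex and $\Omega$ is a closed, weakly positive and strong $(p,p)$-supercurrent, then $M(\psi_1,\dots,\psi_k,\Omega)$ is a closed, weakly positive and strong $(p+k,p+k)$-supercurrent. -/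

import Mathlib

open Set Filter Topology
open scoped ContDiff Distributions

noncomputable section

namespace Superform

/-! ### The algebra of superforms at a point -/

/-- The space `ℝⁿ` with its Euclidean structure and standard orthonormal coordinates. -/
abbrev Space (n : ℕ) := EuclideanSpace ℝ (Fin n)

/-- The index set of the real coordinates `x₁, ξ₁, x₂, ξ₂, …, xₙ, ξₙ` of `ℂⁿ`, in this order:
`(i, 0)` stands for `xᵢ` and `(i, 1)` for `ξᵢ`. -/
abbrev Idx (n : ℕ) := Fin n ×ₗ Fin 2

/-- The exterior algebra on `dx₁, dξ₁, …, dxₙ, dξₙ`: superforms at a point. Its product `*` is the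
wedge product. -/
abbrev Alg (n : ℕ) := ExteriorAlgebra ℝ (Idx n → ℝ)

/-- The basis of `Alg n` consisting of the wedge products, in increasing order, of the basis
one-forms. -/
def algBasis (n : ℕ) : Module.Basis (Finset (Idx n)) ℝ (Alg n) :=
  (Pi.basisFun ℝ (Idx n)).ExteriorAlgebra

/-- `Alg n` is normed by the supremum of the coefficients. (It is finite-dimensional, so that all
norms define the same topology and the same smooth functions.) -/
instance algNormedAddCommGroup (n : ℕ) : NormedAddCommGroup (Alg n) :=
  NormedAddCommGroup.induced (Alg n) (Finset (Idx n) → ℝ) (algBasis n).equivFun.toLinearMap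
    (algBasis n).equivFun.injective

instance algNormedSpace (n : ℕ) : NormedSpace ℝ (Alg n) :=
  NormedSpace.induced ℝ (Alg n) (Finset (Idx n) → ℝ) (algBasis n).equivFun.toLinearMap

instance algFinite (n : ℕ) : Module.Finite ℝ (Alg n) := Module.Finite.of_basis (algBasis n)

/-- The one-form `dxᵢ`. -/
def dx {n : ℕ} (i : Fin n) : Alg n := ExteriorAlgebra.ι ℝ (Pi.single (toLex (i, 0)) 1)

/-- The one-form `dξᵢ`. -/
def dxi {n : ℕ} (i : Fin n) : Alg n := ExteriorAlgebra.ι ℝ (Pi.single (toLex (i, 1)) 1)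

/-- The space of forms of bidegree `(p, q)`: the span of the products of `p` of the `dxᵢ` and `q`
of the `dξᵢ`. -/
def bidegree (n p q : ℕ) : Submodule ℝ (Alg n) :=
  Submodule.span ℝ (range (dx (n := n))) ^ p * Submodule.span ℝ (range (dxi (n := n))) ^ q

/-- The action of the complex structure on one-forms: `dxᵢ ↦ -dξᵢ`, `dξᵢ ↦ dxᵢ`. -/
def complexStructure (n : ℕ) : (Idx n → ℝ) →ₗ[ℝ] (Idx n → ℝ) where
  toFun w k := if (ofLex k).2 = 0 then w (toLex ((ofLex k).1, 1)) else -w (toLex ((ofLex k).1, 0))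
  map_add' v w := by
    ext k; by_cases h : (ofLex k).2 = 0 <;> simp [h, add_comm]
  map_smul' c w := by
    ext k; by_cases h : (ofLex k).2 = 0 <;> simp [h]

/-- The complex structure `J` on forms; it is multiplicative. -/
def J (n : ℕ) : Alg n →ₐ[ℝ] Alg n := ExteriorAlgebra.map (complexStructure n)

/-- The coefficient of a form along the volume form
`dV = dx₁ ∧ dξ₁ ∧ dx₂ ∧ dξ₂ ∧ … ∧ dxₙ ∧ dξₙ`. -/
def volCoeff (n : ℕ) : Alg n →ₗ[ℝ] ℝ := (algBasis n).coord Finset.univ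

/-! ### Positivity at a point -/

/-- Elementary `(p, p)`-forms `α₁ ∧ α₁^# ∧ … ∧ α_p ∧ α_p^#`, with `αⱼ` of bidegree `(1, 0)` and
`α^# = -J α`. -/
def IsElementary {n : ℕ} (p : ℕ) (E : Alg n) : Prop :=
  ∃ α : Fin p → Alg n, (∀ j, α j ∈ bidegree n 1 0) ∧
    E = (List.ofFn fun j => α j * (-(J n (α j)))).prod

/-- The cone of strongly positive `(p, p)`-forms: the closure of the set of finite linear
combinations of elementary forms with positive coefficients. -/
def stronglyPositive (n p : ℕ) : Set (Alg n) :=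
  closure {σ | ∃ (N : ℕ) (c : Fin N → ℝ) (E : Fin N → Alg n),
    (∀ s, 0 < c s) ∧ (∀ s, IsElementary p (E s)) ∧ σ = ∑ s, c s • E s}

/-- Symmetric forms of bidegree `(p, p)`. -/
def symmetricForms (n p : ℕ) : Set (Alg n) := {η | η ∈ bidegree n p p ∧ J n η = η}

/-- Weakly positive `(p, p)`-forms: symmetric forms `η` with `η ∧ E ≥ 0` for all elementary
forms `E` of the complementary bidegree. -/
def weaklyPositive (n p : ℕ) : Set (Alg n) :=
  {η | η ∈ symmetricForms n p ∧
    ∀ m : ℕ, p + m = n → ∀ E : Alg n, IsElementary m E → 0 ≤ volCoeff n (η * E)}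

/-- Weakly null `(p, p)`-forms: those that are both weakly positive and weakly negative. -/
def weaklyNull (n p : ℕ) : Set (Alg n) :=
  {η | η ∈ weaklyPositive n p ∧ -η ∈ weaklyPositive n p}

/-! ### Superforms with variable coefficients -/

/-- The wedge product as a continuous bilinear map. -/
def wedgeCLM (n : ℕ) : Alg n →L[ℝ] Alg n →L[ℝ] Alg n :=
  LinearMap.toContinuousLinearMap
    ((LinearMap.toContinuousLinearMap (𝕜 := ℝ) (E := Alg n) (F' := Alg n)).toLinearMap ∘ₗ
      LinearMap.mul ℝ (Alg n))

theorem wedgeCLM_apply {n : ℕ} (a b : Alg n) : wedgeCLM n a b = a * b := rfl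

theorem contDiff_wedge {n : ℕ} {a b : Space n → Alg n} (ha : ContDiff ℝ ∞ a)
    (hb : ContDiff ℝ ∞ b) : ContDiff ℝ ∞ fun x => a x * b x :=
  ((wedgeCLM n).contDiff.comp ha).clm_apply hb

/-- The exterior derivative of a superform, whose coefficients depend only on `x`:
`d α = ∑ⱼ dxⱼ ∧ ∂α/∂xⱼ`. -/
def extD {n : ℕ} (α : Space n → Alg n) (x : Space n) : Alg n :=
  ∑ j, dx j * fderiv ℝ α x (EuclideanSpace.single j 1)

/-- The operator `d^# α = ∑ⱼ dξⱼ ∧ ∂α/∂xⱼ`. -/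
def extDSharp {n : ℕ} (α : Space n → Alg n) (x : Space n) : Alg n :=
  ∑ j, dxi j * fderiv ℝ α x (EuclideanSpace.single j 1)

/-- The `(1, 1)`-form `d d^# ψ` of a function `ψ`. -/
def ddSharp {n : ℕ} (ψ : Space n → ℝ) : Space n → Alg n :=
  extD (extDSharp fun x => algebraMap ℝ (Alg n) (ψ x))

/-- The form `dd^#ψ₁ ∧ … ∧ dd^#ψ_k`, of bidegree `(k, k)`. -/
def ddSharpWedge {n k : ℕ} (ψ : Fin k → Space n → ℝ) (x : Space n) : Alg n :=
  (List.ofFn fun j => ddSharp (ψ j) x).prod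

theorem contDiff_fderiv_single {n : ℕ} {α : Space n → Alg n} (h : ContDiff ℝ ∞ α) (j : Fin n) :
    ContDiff ℝ ∞ fun x => fderiv ℝ α x (EuclideanSpace.single j 1) :=
  (h.fderiv_right (m := ∞) (by simp)).clm_apply contDiff_const

theorem contDiff_extD {n : ℕ} {α : Space n → Alg n} (h : ContDiff ℝ ∞ α) :
    ContDiff ℝ ∞ (extD α) :=
  ContDiff.sum fun j _ => contDiff_wedge contDiff_const (contDiff_fderiv_single h j)

theorem contDiff_extDSharp {n : ℕ} {α : Space n → Alg n} (h : ContDiff ℝ ∞ α) :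
    ContDiff ℝ ∞ (extDSharp α) :=
  ContDiff.sum fun j _ => contDiff_wedge contDiff_const (contDiff_fderiv_single h j)

theorem contDiff_ddSharp {n : ℕ} {ψ : Space n → ℝ} (h : ContDiff ℝ ∞ ψ) :
    ContDiff ℝ ∞ (ddSharp ψ) :=
  contDiff_extD (contDiff_extDSharp
    ((LinearMap.toContinuousLinearMap (Algebra.linearMap ℝ (Alg n))).contDiff.comp h))

theorem contDiff_ddSharpWedge {n k : ℕ} {ψ : Fin k → Space n → ℝ}
    (h : ∀ j, ContDiff ℝ ∞ (ψ j)) : ContDiff ℝ ∞ (ddSharpWedge ψ) := by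
  induction k with
  | zero =>
    have : ddSharpWedge ψ = fun _ => 1 := by
      funext x; simp [ddSharpWedge]
    rw [this]
    exact contDiff_const
  | succ k ih =>
    have : ddSharpWedge ψ = fun x => ddSharp (ψ 0) x * ddSharpWedge (fun j => ψ j.succ) x := by
      funext x; simp [ddSharpWedge, List.ofFn_succ]
    rw [this]
    exact contDiff_wedge (contDiff_ddSharp (h 0)) (ih fun j => h j.succ)

/-- Smooth superforms (of arbitrary, possibly mixed, bidegree) on `ℝⁿ` with compact support, with
the usual topology of the space of test functions. -/
abbrev TestForm (n : ℕ) := 𝓓((⊤ : TopologicalSpace.Opens (Space n)), Alg n)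

/-- The exterior derivative of a test form. -/
def TestForm.d {n : ℕ} (χ : TestForm n) : TestForm n where
  toFun := extD χ
  contDiff' := contDiff_extD χ.contDiff
  hasCompactSupport' := χ.hasCompactSupport.mono' fun x hx => by
    by_contra h
    exact hx (by simp [extD, fderiv_of_notMem_tsupport (𝕜 := ℝ) h])
  tsupport_subset' := by simp

/-- The complex structure acting on test forms. -/
def TestForm.complexJ {n : ℕ} (χ : TestForm n) : TestForm n where
  toFun x := J n (χ x)
  contDiff' := (LinearMap.toContinuousLinearMap (J n).toLinearMap).contDiff.comp χ.contDiff
  hasCompactSupport' := χ.hasCompactSupport.mono' fun x hx => by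
    by_contra h
    exact hx (by simp [image_eq_zero_of_notMem_tsupport h])
  tsupport_subset' := by simp

/-- The test form `θ ∧ χ`, for a smooth form `θ` and a test form `χ`. -/
def TestForm.wedge {n : ℕ} (θ : Space n → Alg n) (hθ : ContDiff ℝ ∞ θ) (χ : TestForm n) :
    TestForm n where
  toFun x := θ x * χ x
  contDiff' := contDiff_wedge hθ χ.contDiff
  hasCompactSupport' := χ.hasCompactSupport.mono' fun x hx => by
    by_contra h
    exact hx (by simp [image_eq_zero_of_notMem_tsupport h])
  tsupport_subset' := by simp

/-! ### Supercurrents -/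

/-- Supercurrents on `ℝⁿ` (of arbitrary, possibly mixed, bidegree): the dual of the space of test
forms, with the weak* topology. `T χ` is the number `∫ T ∧ χ`. -/
abbrev Supercurrent (n : ℕ) := WeakDual ℝ (TestForm n)

/-- `T` is of bidegree `(p, q)`: it is a functional on the test forms of bidegree
`(n - p, n - q)`, that is, all other bidegree components of a test form contribute zero. -/
def HasBidegree {n : ℕ} (p q : ℕ) (T : Supercurrent n) : Prop :=
  ∀ a b : ℕ, ¬(a + p = n ∧ b + q = n) →
    ∀ χ : TestForm n, (∀ x, χ x ∈ bidegree n a b) → T χ = 0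

/-- `T` is closed: `dT = 0`. -/
def IsClosedCurrent {n : ℕ} (T : Supercurrent n) : Prop := ∀ χ : TestForm n, T χ.d = 0

/-- Symmetric currents of bidegree `(p, p)`: `J T = T`, where `J T` is given by
`∫ J T ∧ χ = ∫ T ∧ J χ`. -/
def IsSymmetricCurrent {n : ℕ} (p : ℕ) (T : Supercurrent n) : Prop :=
  HasBidegree p p T ∧ ∀ χ : TestForm n, T χ.complexJ = T χ

/-- Weakly positive `(p, p)`-currents: symmetric currents that are nonnegative on strongly positive
test forms of bidegree `(n - p, n - p)`. -/
def IsWeaklyPositiveCurrent {n : ℕ} (p : ℕ) (T : Supercurrent n) : Prop :=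
  IsSymmetricCurrent p T ∧ ∀ m : ℕ, m + p = n →
    ∀ χ : TestForm n, (∀ x, χ x ∈ stronglyPositive n m) → 0 ≤ T χ

/-- Strong `(p, p)`-currents, defined by duality: symmetric currents that annihilate the weakly null
test forms of bidegree `(n - p, n - p)`. -/
def IsStrongCurrent {n : ℕ} (p : ℕ) (T : Supercurrent n) : Prop :=
  IsSymmetricCurrent p T ∧ ∀ m : ℕ, m + p = n →
    ∀ χ : TestForm n, (∀ x, χ x ∈ weaklyNull n m) → T χ = 0

/-- Closed, weakly positive, strong currents of bidegree `(p, p)`. -/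
def IsClosedWeaklyPositiveStrong {n : ℕ} (p : ℕ) (T : Supercurrent n) : Prop :=
  IsClosedCurrent T ∧ IsWeaklyPositiveCurrent p T ∧ IsStrongCurrent p T

end Superform

end

open Superform

/-! The product is built one factor at a time. If `ψ` is smooth and convex, its Hessian at a point
is a sum of squares of linear forms, so `dd^#ψ` is there a sum of elementary forms `α ∧ α^#`.
Multiplication by it therefore preserves strongly positive and weakly null forms. Dually, `Ω ↦ dd^#ψ
∧ Ω` preserves closed, weakly positive, strong currents
(`isClosedWeaklyPositiveStrong_wedgeCurrent`). Since `Ω` is closed and symmetric, integration by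
parts gives `∫ dd^#ψ ∧ Ω ∧ χ = -∫ ψ Ω ∧ d^#dχ` (`apply_wedge_ddSharp`), and the right side involves
no derivative of `ψ`.

To let `ψ` be merely convex, `Ω` has to be of order zero: `|∫ Ω ∧ χ| ≤ sup ‖χ‖ · ∫ Ω ∧ κ` for `χ`
supported in a compact `K`, with `κ` depending only on `K` and `p` (`exists_isMassBound`). Weak
positivity gives this for `χ = φ E` with `E` elementary. It extends to all forms because every
symmetric form is a combination of elementary forms and weakly null ones
(`symmetricForms_subset_span`), and a strong current ignores the latter. That decomposition is dual
to a nondegeneracy: a combination of elementary `(p, p)`-forms whose wedge with every elementary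
form of complementary bidegree vanishes is zero (`eq_zero_of_mem_span_isElementary`), which follows
from a sum of squares in Plücker coordinates.

The mass bound makes the products with smooth convex approximations of `ψ` converge on every test
form, and the limit satisfies the quantitative estimate in `IsConvexWedge`. There `Ω` enters the
error only through `∫ Ω ∧ κ`, which stays bounded along weak* convergent sequences. Hence joint
continuity in `ψ` and `Ω` (`IsConvexWedge.tendsto`), and induction on `k` finishes the proof. -/

namespace Superform

/-! ### One-forms with constant coefficients -/

/-- The embedding of `ℝⁿ` into the space of covectors on `ℂⁿ` along the coordinates `xᵢ` (for
`s = 0`) or `ξᵢ` (for `s = 1`). -/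
def embedCovector (n : ℕ) (s : Fin 2) : (Fin n → ℝ) →ₗ[ℝ] (Idx n → ℝ) where
  toFun a k := if (ofLex k).2 = s then a (ofLex k).1 else 0
  map_add' a b := by ext k; by_cases h : (ofLex k).2 = s <;> simp [h]
  map_smul' c a := by ext k; by_cases h : (ofLex k).2 = s <;> simp [h]

theorem embedCovector_apply {n : ℕ} (s : Fin 2) (a : Fin n → ℝ) (k : Idx n) :
    embedCovector n s a k = if (ofLex k).2 = s then a (ofLex k).1 else 0 := rfl

theorem embedCovector_single {n : ℕ} (s : Fin 2) (i : Fin n) :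
    embedCovector n s (Pi.single i 1) = Pi.single (toLex (i, s)) 1 := by
  ext k
  obtain ⟨⟨j, t⟩, rfl⟩ := toLex.surjective k
  by_cases hj : j = i <;> by_cases ht : t = s <;> simp [embedCovector_apply, hj, ht]

/-- The one-form `∑ aᵢ dxᵢ`. -/
noncomputable def xForm {n : ℕ} : (Fin n → ℝ) →ₗ[ℝ] Alg n := ExteriorAlgebra.ι ℝ ∘ₗ embedCovector n 0

/-- The one-form `∑ aᵢ dξᵢ`. -/
noncomputable def xiForm {n : ℕ} : (Fin n → ℝ) →ₗ[ℝ] Alg n := ExteriorAlgebra.ι ℝ ∘ₗ embedCovector n 1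

theorem xForm_single {n : ℕ} (i : Fin n) : xForm (Pi.single i 1) = dx i := by
  simp [xForm, dx, embedCovector_single]

theorem xiForm_single {n : ℕ} (i : Fin n) : xiForm (Pi.single i 1) = dxi i := by
  simp [xiForm, dxi, embedCovector_single]

theorem xForm_eq_sum {n : ℕ} (a : Fin n → ℝ) : xForm a = ∑ i, a i • dx i := by
  conv_lhs => rw [pi_eq_sum_univ' a]
  simp [← xForm_single, map_sum]

theorem xiForm_eq_sum {n : ℕ} (a : Fin n → ℝ) : xiForm a = ∑ i, a i • dxi i := by
  conv_lhs => rw [pi_eq_sum_univ' a]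
  simp [← xiForm_single, map_sum]

theorem range_xForm (n : ℕ) :
    LinearMap.range (xForm (n := n)) = Submodule.span ℝ (range (dx (n := n))) := by
  apply le_antisymm
  · rintro _ ⟨a, rfl⟩
    rw [xForm_eq_sum]
    exact Submodule.sum_mem _ fun i _ => Submodule.smul_mem _ _ (Submodule.subset_span ⟨i, rfl⟩)
  · rw [Submodule.span_le]
    rintro _ ⟨i, rfl⟩
    exact ⟨_, xForm_single i⟩

theorem range_xiForm (n : ℕ) :
    LinearMap.range (xiForm (n := n)) = Submodule.span ℝ (range (dxi (n := n))) := by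
  apply le_antisymm
  · rintro _ ⟨a, rfl⟩
    rw [xiForm_eq_sum]
    exact Submodule.sum_mem _ fun i _ => Submodule.smul_mem _ _ (Submodule.subset_span ⟨i, rfl⟩)
  · rw [Submodule.span_le]
    rintro _ ⟨i, rfl⟩
    exact ⟨_, xiForm_single i⟩

theorem J_xForm {n : ℕ} (a : Fin n → ℝ) : J n (xForm a) = -xiForm a := by
  simp only [J, xForm, xiForm, LinearMap.comp_apply, ExteriorAlgebra.map_apply_ι, ← map_neg]
  congr 1
  ext k
  obtain ⟨⟨j, t⟩, rfl⟩ := toLex.surjective k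
  fin_cases t <;> simp [complexStructure, embedCovector_apply]

theorem J_xiForm {n : ℕ} (a : Fin n → ℝ) : J n (xiForm a) = xForm a := by
  simp only [J, xForm, xiForm, LinearMap.comp_apply, ExteriorAlgebra.map_apply_ι]
  congr 1
  ext k
  obtain ⟨⟨j, t⟩, rfl⟩ := toLex.surjective k
  fin_cases t <;> simp [complexStructure, embedCovector_apply]

theorem xForm_mul_xForm {n : ℕ} (a b : Fin n → ℝ) : xForm a * xForm b = -(xForm b * xForm a) :=
  eq_neg_of_add_eq_zero_left (ExteriorAlgebra.ι_add_mul_swap _ _)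

theorem xiForm_mul_xForm {n : ℕ} (a b : Fin n → ℝ) : xiForm a * xForm b = -(xForm b * xiForm a) :=
  eq_neg_of_add_eq_zero_left (ExteriorAlgebra.ι_add_mul_swap _ _)

/-! ### Bidegrees -/

theorem mem_bidegree_one_zero {n : ℕ} {η : Alg n} :
    η ∈ bidegree n 1 0 ↔ ∃ a, η = xForm a := by
  rw [bidegree, pow_one, pow_zero, mul_one, ← range_xForm]
  exact ⟨fun ⟨a, h⟩ => ⟨a, h.symm⟩, fun ⟨a, h⟩ => ⟨a, h.symm⟩⟩

theorem isElementary_iff {n p : ℕ} {E : Alg n} :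
    IsElementary p E ↔
      ∃ a : Fin p → Fin n → ℝ, E = (List.ofFn fun j => xForm (a j) * xiForm (a j)).prod := by
  constructor
  · rintro ⟨α, hα, rfl⟩
    choose a ha using fun j => mem_bidegree_one_zero.1 (hα j)
    exact ⟨a, by simp [ha, J_xForm]⟩
  · rintro ⟨a, rfl⟩
    exact ⟨fun j => xForm (a j), fun j => mem_bidegree_one_zero.2 ⟨_, rfl⟩, by simp [J_xForm]⟩

theorem commute_span_dx_span_dxi (n : ℕ) :
    Commute (Submodule.span ℝ (range (dx (n := n)))) (Submodule.span ℝ (range (dxi (n := n)))) := by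
  rw [← range_xForm, ← range_xiForm]
  apply le_antisymm <;> rw [Submodule.mul_le]
  · rintro _ ⟨a, rfl⟩ _ ⟨b, rfl⟩
    rw [← neg_neg (xForm a * xiForm b), ← xiForm_mul_xForm]
    exact neg_mem (Submodule.mul_mem_mul ⟨b, rfl⟩ ⟨a, rfl⟩)
  · rintro _ ⟨a, rfl⟩ _ ⟨b, rfl⟩
    rw [xiForm_mul_xForm]
    exact neg_mem (Submodule.mul_mem_mul ⟨b, rfl⟩ ⟨a, rfl⟩)

theorem bidegree_mul_bidegree (n p q r s : ℕ) :
    bidegree n p q * bidegree n r s = bidegree n (p + r) (q + s) := by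
  have h := (commute_span_dx_span_dxi n).symm.pow_pow q r
  unfold bidegree
  rw [pow_add, pow_add, mul_assoc, mul_assoc, ← mul_assoc (_ ^ q), h.eq, mul_assoc]

theorem mul_mem_bidegree {n p q r s : ℕ} {η θ : Alg n} (hη : η ∈ bidegree n p q)
    (hθ : θ ∈ bidegree n r s) : η * θ ∈ bidegree n (p + r) (q + s) :=
  bidegree_mul_bidegree n p q r s ▸ Submodule.mul_mem_mul hη hθ

theorem xForm_mem_bidegree {n : ℕ} (a : Fin n → ℝ) : xForm a ∈ bidegree n 1 0 :=
  mem_bidegree_one_zero.2 ⟨a, rfl⟩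

theorem xiForm_mem_bidegree {n : ℕ} (a : Fin n → ℝ) : xiForm a ∈ bidegree n 0 1 := by
  rw [bidegree, pow_one, pow_zero, one_mul, ← range_xiForm]
  exact ⟨a, rfl⟩

theorem one_mem_bidegree (n : ℕ) : (1 : Alg n) ∈ bidegree n 0 0 := by
  rw [bidegree, pow_zero, pow_zero, one_mul]
  exact Submodule.one_le.1 le_rfl

theorem map_J_bidegree (n p q : ℕ) : (bidegree n p q).map (J n).toLinearMap = bidegree n q p := by
  have h1 : (LinearMap.range (xForm (n := n))).map (J n).toLinearMap
      = LinearMap.range (xiForm (n := n)) := by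
    ext η; constructor
    · rintro ⟨_, ⟨a, rfl⟩, rfl⟩; exact ⟨-a, by simp [J_xForm]⟩
    · rintro ⟨a, rfl⟩; exact ⟨_, ⟨-a, rfl⟩, by simp [J_xForm]⟩
  have h2 : (LinearMap.range (xiForm (n := n))).map (J n).toLinearMap
      = LinearMap.range (xForm (n := n)) := by
    ext η; constructor
    · rintro ⟨_, ⟨a, rfl⟩, rfl⟩; exact ⟨a, by simp [J_xiForm]⟩
    · rintro ⟨a, rfl⟩; exact ⟨_, ⟨a, rfl⟩, by simp [J_xiForm]⟩
  have h := commute_span_dx_span_dxi n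
  rw [← range_xForm, ← range_xiForm] at h
  rw [bidegree, bidegree, ← range_xForm, ← range_xiForm, Submodule.map_mul, Submodule.map_pow,
    Submodule.map_pow, h1, h2, (h.symm.pow_pow p q).eq]

theorem J_mem_bidegree {n p q : ℕ} {η : Alg n} (h : η ∈ bidegree n p q) :
    J n η ∈ bidegree n q p := by
  rw [← map_J_bidegree]; exact ⟨η, h, rfl⟩

/-- `J² = -1` on one-forms and `J` is multiplicative. In particular `J` is an involution on `(m,
m)`-forms, which splits them into symmetric and antisymmetric parts. -/
theorem J_J_of_mem_bidegree {n p q : ℕ} {η : Alg n} (h : η ∈ bidegree n p q) :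
    J n (J n η) = (-1 : ℝ) ^ (p + q) • η := by
  have hx : ∀ (V : Submodule ℝ (Alg n)), (∀ v ∈ V, J n (J n v) = -v) →
      ∀ k : ℕ, ∀ v ∈ V ^ k, J n (J n v) = (-1 : ℝ) ^ k • v := by
    intro V hV k
    induction k with
    | zero =>
      intro v hv
      obtain ⟨r, rfl⟩ := Submodule.mem_one.1 hv
      simp
    | succ k ih =>
      intro v hv
      rw [pow_succ] at hv
      induction hv using Submodule.mul_induction_on' with
      | mem_mul_mem a ha b hb =>
        simp only [map_mul, ih a ha, hV b hb, pow_succ]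
        simp
      | add a _ b _ ha hb => simp only [map_add, ha, hb, smul_add]
  have hx1 : ∀ v ∈ Submodule.span ℝ (range (dx (n := n))), J n (J n v) = -v := by
    rw [← range_xForm]; rintro _ ⟨a, rfl⟩; simp [J_xForm, J_xiForm]
  have hx2 : ∀ v ∈ Submodule.span ℝ (range (dxi (n := n))), J n (J n v) = -v := by
    rw [← range_xiForm]; rintro _ ⟨a, rfl⟩; simp [J_xForm, J_xiForm]
  rw [bidegree] at h
  induction h using Submodule.mul_induction_on' with
  | mem_mul_mem a ha b hb =>
    rw [map_mul, map_mul, hx _ hx1 p a ha, hx _ hx2 q b hb, smul_mul_smul_comm, pow_add]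
  | add a _ b _ ha hb => simp only [map_add, ha, hb, smul_add]

theorem iSup_bidegree (n : ℕ) : ⨆ pq : ℕ × ℕ, bidegree n pq.1 pq.2 = ⊤ := by
  rw [eq_top_iff]
  rintro η -
  induction η using ExteriorAlgebra.induction with
  | algebraMap r =>
    refine Submodule.mem_iSup_of_mem (0, 0) ?_
    rw [Algebra.algebraMap_eq_smul_one]
    exact Submodule.smul_mem _ _ (one_mem_bidegree n)
  | ι w =>
    have : w = embedCovector n 0 (fun i => w (toLex (i, 0))) +
        embedCovector n 1 (fun i => w (toLex (i, 1))) := by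
      ext k
      obtain ⟨⟨j, t⟩, rfl⟩ := toLex.surjective k
      fin_cases t <;> simp [embedCovector_apply]
    rw [this, map_add]
    exact add_mem (Submodule.mem_iSup_of_mem (1, 0) (xForm_mem_bidegree _))
      (Submodule.mem_iSup_of_mem (0, 1) (xiForm_mem_bidegree _))
  | mul a b ha hb =>
    have : (⨆ pq : ℕ × ℕ, bidegree n pq.1 pq.2) * (⨆ pq : ℕ × ℕ, bidegree n pq.1 pq.2)
        ≤ ⨆ pq : ℕ × ℕ, bidegree n pq.1 pq.2 := by
      rw [Submodule.iSup_mul]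
      refine iSup_le fun pq => ?_
      rw [Submodule.mul_iSup]
      refine iSup_le fun rs => ?_
      rw [bidegree_mul_bidegree]
      exact le_iSup (fun pq : ℕ × ℕ => bidegree n pq.1 pq.2) (pq.1 + rs.1, pq.2 + rs.2)
    exact this (Submodule.mul_mem_mul ha hb)
  | add a b ha hb => exact add_mem ha hb

/-! ### Elementary forms -/

theorem xForm_mul_xiForm_mem {n : ℕ} (a b : Fin n → ℝ) : xForm a * xiForm b ∈ bidegree n 1 1 := by
  have := mul_mem_bidegree (xForm_mem_bidegree a) (xiForm_mem_bidegree b)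
  rwa [add_zero, zero_add] at this

theorem J_xForm_mul_xiForm {n : ℕ} (a b : Fin n → ℝ) :
    J n (xForm a * xiForm b) = xForm b * xiForm a := by
  rw [map_mul, J_xForm, J_xiForm, neg_mul, xiForm_mul_xForm, neg_neg]

theorem mul_mem_symmetricForms {n p q : ℕ} {η θ : Alg n} (hη : η ∈ symmetricForms n p)
    (hθ : θ ∈ symmetricForms n q) : η * θ ∈ symmetricForms n (p + q) :=
  ⟨mul_mem_bidegree hη.1 hθ.1, by rw [map_mul, hη.2, hθ.2]⟩

theorem xForm_mul_xiForm_mem_symmetricForms {n : ℕ} (a : Fin n → ℝ) :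
    xForm a * xiForm a ∈ symmetricForms n 1 :=
  ⟨xForm_mul_xiForm_mem a a, J_xForm_mul_xiForm a a⟩

theorem isElementary_mul {n p q : ℕ} {E F : Alg n} (hE : IsElementary p E)
    (hF : IsElementary q F) : IsElementary (p + q) (E * F) := by
  rw [isElementary_iff] at *
  obtain ⟨a, rfl⟩ := hE
  obtain ⟨b, rfl⟩ := hF
  refine ⟨Fin.append a b, ?_⟩
  rw [← List.prod_append, ← List.ofFn_fin_append]
  congr 2
  ext j
  refine Fin.addCases (fun i => ?_) (fun i => ?_) j <;> simp

theorem isElementary_one {n : ℕ} (a : Fin n → ℝ) : IsElementary 1 (xForm a * xiForm a) :=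
  isElementary_iff.2 ⟨fun _ => a, by simp⟩

theorem IsElementary.mem_symmetricForms {n p : ℕ} {E : Alg n} (hE : IsElementary p E) :
    E ∈ symmetricForms n p := by
  rw [isElementary_iff] at hE
  obtain ⟨a, rfl⟩ := hE
  induction p with
  | zero =>
    rw [List.ofFn_zero, List.prod_nil]
    exact ⟨one_mem_bidegree n, map_one (J n)⟩
  | succ p ih =>
    have := mul_mem_symmetricForms (xForm_mul_xiForm_mem_symmetricForms (a 0)) (ih (a ∘ Fin.succ))
    rw [add_comm 1 p] at this
    rw [List.ofFn_succ, List.prod_cons]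
    exact this

theorem commute_xForm_mul_xiForm {n : ℕ} (a b : Fin n → ℝ) (η : Alg n) :
    Commute (xForm a * xiForm b) η := by
  induction η using ExteriorAlgebra.induction with
  | algebraMap r => exact (Algebra.commutes r _).symm
  | ι w =>
    have h1 : xForm a * ExteriorAlgebra.ι ℝ w = -(ExteriorAlgebra.ι ℝ w * xForm a) :=
      eq_neg_of_add_eq_zero_left (ExteriorAlgebra.ι_add_mul_swap _ _)
    have h2 : xiForm b * ExteriorAlgebra.ι ℝ w = -(ExteriorAlgebra.ι ℝ w * xiForm b) :=
      eq_neg_of_add_eq_zero_left (ExteriorAlgebra.ι_add_mul_swap _ _)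
    rw [Commute, SemiconjBy, mul_assoc, h2, mul_neg, ← mul_assoc, h1, neg_mul, neg_neg, mul_assoc]
  | mul x y hx hy => exact hx.mul_right hy
  | add x y hx hy => exact hx.add_right hy

/-! ### Alternating maps and the positive definite pairing of elementary forms -/

/-- A Cauchy–Binet expansion. The sum runs over all index maps rather than increasing ones, so each
minor is counted `p!` times. It is applied below both to Gram determinants and to `xProd`, `xiProd`.
-/
theorem factorial_smul_alternatingMap_apply {n p : ℕ} {W : Type*} [AddCommGroup W] [Module ℝ W]
    (A : (Fin n → ℝ) [⋀^Fin p]→ₗ[ℝ] W) (v : Fin p → Fin n → ℝ) :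
    (p.factorial : ℝ) • A v = ∑ f : Fin p → Fin n,
      Matrix.det (Matrix.of fun i j => v i (f j)) • A fun j => Pi.single (f j) 1 := by
  have h1 : A v = ∑ f : Fin p → Fin n, (∏ i, v i (f i)) • A fun j => Pi.single (f j) 1 := by
    have hv : v = fun i => ∑ k, v i k • (Pi.single k 1 : Fin n → ℝ) := by
      funext i
      exact pi_eq_sum_univ' (v i)
    conv_lhs => rw [hv]
    refine (A.toMultilinearMap.map_sum (fun i k => v i k • (Pi.single k 1 : Fin n → ℝ))).trans ?_
    refine Finset.sum_congr rfl fun f _ => ?_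
    exact A.toMultilinearMap.map_smul_univ (fun i => v i (f i)) _
  -- Reindexing the multilinear expansion by `σ` costs the sign of `σ`; summing over all `σ` then
  -- assembles the determinants.
  have h2 : ∀ σ : Equiv.Perm (Fin p), A v = ∑ f : Fin p → Fin n,
      ((Equiv.Perm.sign σ : ℤ) * ∏ i, v i (f (σ i)) : ℝ) • A fun j => Pi.single (f j) 1 := by
    intro σ
    rw [h1, ← (Equiv.arrowCongr σ (Equiv.refl (Fin n))).symm.sum_comp]
    refine Finset.sum_congr rfl fun f _ => ?_
    have : (fun j => (Pi.single ((Equiv.arrowCongr σ (Equiv.refl (Fin n))).symm f j) 1 : Fin n → ℝ))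
        = (fun j => Pi.single (f j) 1) ∘ σ := by
      funext j; simp [Equiv.arrowCongr]
    rw [this, A.map_perm, mul_comm, mul_smul, Units.smul_def, Int.cast_smul_eq_zsmul]
    simp [Equiv.arrowCongr]
  have h3 : ∑ _σ : Equiv.Perm (Fin p), A v = (p.factorial : ℝ) • A v := by
    rw [Finset.sum_const, Finset.card_univ, Fintype.card_perm, Fintype.card_fin, Nat.cast_smul_eq_nsmul]
  rw [← h3, Finset.sum_congr rfl fun σ _ => h2 σ, Finset.sum_comm]
  refine Finset.sum_congr rfl fun f _ => ?_
  rw [← Finset.sum_smul, ← Matrix.det_transpose, Matrix.det_apply']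
  rfl

/-- The product `(∑ a₁ᵢ dxᵢ) ∧ … ∧ (∑ a_{pi} dxᵢ)` as an alternating map. -/
noncomputable def xProd (n p : ℕ) : (Fin n → ℝ) [⋀^Fin p]→ₗ[ℝ] Alg n :=
  (ExteriorAlgebra.ιMulti ℝ p).compLinearMap (embedCovector n 0)

/-- The product `(∑ a₁ᵢ dξᵢ) ∧ … ∧ (∑ a_{pi} dξᵢ)` as an alternating map. -/
noncomputable def xiProd (n p : ℕ) : (Fin n → ℝ) [⋀^Fin p]→ₗ[ℝ] Alg n :=
  (ExteriorAlgebra.ιMulti ℝ p).compLinearMap (embedCovector n 1)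

theorem xProd_succ {n p : ℕ} (a : Fin (p + 1) → Fin n → ℝ) :
    xProd n (p + 1) a = xForm (a 0) * xProd n p (fun j => a j.succ) := by
  simp only [xProd, xForm, AlternatingMap.compLinearMap_apply, ExteriorAlgebra.ιMulti_apply,
    List.ofFn_succ, List.prod_cons, LinearMap.comp_apply]

theorem xiProd_succ {n p : ℕ} (a : Fin (p + 1) → Fin n → ℝ) :
    xiProd n (p + 1) a = xiForm (a 0) * xiProd n p (fun j => a j.succ) := by
  simp only [xiProd, xiForm, AlternatingMap.compLinearMap_apply, ExteriorAlgebra.ιMulti_apply,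
    List.ofFn_succ, List.prod_cons, LinearMap.comp_apply]

theorem xiForm_mul_xProd {n p : ℕ} (b : Fin n → ℝ) (a : Fin p → Fin n → ℝ) :
    xiForm b * xProd n p a = (-1 : ℝ) ^ p • (xProd n p a * xiForm b) := by
  induction p with
  | zero => simp [xProd]
  | succ p ih =>
    rw [xProd_succ, ← mul_assoc, xiForm_mul_xForm, neg_mul, mul_assoc, ih, pow_succ, mul_smul,
      mul_smul_comm, mul_assoc]
    simp

/-- Sorting the `dx` factors before the `dξ` factors only costs a sign that depends on `p` alone. -/
theorem exists_prod_eq_smul_xProd_mul_xiProd (n p : ℕ) :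
    ∃ s : ℝ, s ≠ 0 ∧ ∀ a b : Fin p → Fin n → ℝ,
      (List.ofFn fun j => xForm (a j) * xiForm (b j)).prod = s • (xProd n p a * xiProd n p b) := by
  induction p with
  | zero => exact ⟨1, one_ne_zero, fun a b => by simp [xProd, xiProd]⟩
  | succ p ih =>
    obtain ⟨s, hs, h⟩ := ih
    refine ⟨s * (-1) ^ p, by simpa using hs, fun a b => ?_⟩
    rw [List.ofFn_succ, List.prod_cons, h, xProd_succ, xiProd_succ, mul_smul_comm, mul_smul]
    congr 1
    rw [mul_assoc, ← mul_assoc (xiForm _), xiForm_mul_xProd, smul_mul_assoc, mul_smul_comm,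
      mul_assoc, mul_assoc]

theorem exists_prod_ι_single_eq {n : ℕ} (l : List (Idx n)) (hl : l.Nodup) :
    ∃ u : ℤˣ, (l.map fun k => ExteriorAlgebra.ι ℝ (Pi.single k (1 : ℝ))).prod
      = u • algBasis n l.toFinset := by
  have hcard : ∀ k : Idx n, ({k} : Finset (Idx n)).card = 1 := fun k => Finset.card_singleton k
  induction l with
  | nil =>
    refine ⟨1, ?_⟩
    rw [algBasis, List.toFinset_nil, ExteriorAlgebra.basis_apply_ofCard _ Finset.card_empty]
    simp [ExteriorAlgebra.ιMulti_family]
  | cons k l ih =>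
    obtain ⟨u, hu⟩ := ih hl.of_cons
    have hk : k ∉ l.toFinset := by simpa using (List.nodup_cons.1 hl).1
    have hb : ExteriorAlgebra.ι ℝ (Pi.single k (1 : ℝ)) = algBasis n {k} := by
      rw [algBasis, ExteriorAlgebra.basis_apply_ofCard _ (hcard k)]
      simp only [ExteriorAlgebra.ιMulti_family, ExteriorAlgebra.ιMulti_apply, List.ofFn_succ,
        List.ofFn_zero, List.prod_cons, List.prod_nil, mul_one, Function.comp_apply,
        Pi.basisFun_apply]
      have : Set.powersetCard.ofFinEmbEquiv.symm (Set.powersetCard.ofCard (hcard k)) 0 ∈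
          ({k} : Finset (Idx n)) :=
        Finset.orderEmbOfFin_mem _ (hcard k) 0
      rw [Finset.mem_singleton.1 this]
    have hdis : Disjoint (Set.powersetCard.ofCard (hcard k)).val
        (Set.powersetCard.ofCard (s := l.toFinset) rfl).val := by
      simpa [Set.powersetCard.ofCard] using hk
    have hm := ExteriorAlgebra.basis_mul_of_disjoint (Pi.basisFun ℝ (Idx n)) _ _ hdis
    refine ⟨u * (Set.powersetCard.permOfDisjoint hdis).sign, ?_⟩
    rw [List.map_cons, List.prod_cons, hu, hb, mul_smul_comm, mul_smul]
    congr 1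
    refine hm.trans ?_
    congr 2
    simp [Set.powersetCard.disjUnion, Set.powersetCard.ofCard]

/-- The monomial `dx₁ ∧ … ∧ dxₙ ∧ dξ₁ ∧ … ∧ dξₙ` is a reordering of the volume form. Its sign is
never needed. -/
theorem volCoeff_xProd_mul_xiProd_ne_zero (n : ℕ) :
    volCoeff n (xProd n n (fun i => Pi.single i 1) * xiProd n n fun i => Pi.single i 1) ≠ 0 := by
  set l : List (Idx n) := (List.finRange n).map (fun i => toLex (i, 0)) ++
    (List.finRange n).map (fun i => toLex (i, 1)) with hl
  have hnd : l.Nodup := by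
    rw [hl, List.nodup_append']
    refine ⟨?_, ?_, ?_⟩
    · exact (List.nodup_finRange n).map fun i j h => by simpa using h
    · exact (List.nodup_finRange n).map fun i j h => by simpa using h
    · intro a h1 h2
      simp only [List.mem_map] at h1 h2
      obtain ⟨i, -, rfl⟩ := h1
      obtain ⟨j, -, h⟩ := h2
      simp at h
  have huniv : l.toFinset = Finset.univ := by
    ext k
    obtain ⟨⟨j, t⟩, rfl⟩ := toLex.surjective k
    fin_cases t <;> simp [hl]
  obtain ⟨u, hu⟩ := exists_prod_ι_single_eq l hnd
  have : xProd n n (fun i => Pi.single i 1) * xiProd n n (fun i => Pi.single i 1)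
      = (l.map fun k => ExteriorAlgebra.ι ℝ (Pi.single k (1 : ℝ))).prod := by
    simp only [xProd, xiProd, AlternatingMap.compLinearMap_apply, ExteriorAlgebra.ιMulti_apply,
      embedCovector_single, hl, List.map_append, List.prod_append, List.map_map,
      List.ofFn_eq_map]
    rfl
  rw [this, hu, huniv, volCoeff]
  rcases Int.units_eq_one_or u with rfl | rfl <;> simp [Units.smul_def]

theorem exists_volCoeff_prod_eq (n : ℕ) : ∃ c : ℝ, c ≠ 0 ∧ ∀ a : Fin n → Fin n → ℝ,
    volCoeff n (List.ofFn fun j => xForm (a j) * xiForm (a j)).prod = c * (Matrix.of a).det ^ 2 := by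
  obtain ⟨s, hs, h⟩ := exists_prod_eq_smul_xProd_mul_xiProd n n
  refine ⟨s * volCoeff n (xProd n n (fun i => Pi.single i 1) * xiProd n n fun i => Pi.single i 1),
    mul_ne_zero hs (volCoeff_xProd_mul_xiProd_ne_zero n), fun a => ?_⟩
  have key : ∀ f : (Fin n → ℝ) [⋀^Fin n]→ₗ[ℝ] ℝ, f a = f (fun i => Pi.single i 1) * (Matrix.of a).det := by
    intro f
    conv_lhs => rw [f.eq_smul_basis_det (Pi.basisFun ℝ (Fin n))]
    rw [AlternatingMap.smul_apply, smul_eq_mul, Pi.basisFun_det_apply]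
    congr 2
    funext i
    simp
  -- The determinant is extracted twice: from the `dx` factor with the `dξ` factor frozen at `a`,
  -- then from the `dξ` factor with the `dx` factor already at the standard basis.
  have h1 := key ((volCoeff n ∘ₗ LinearMap.mulRight ℝ (xiProd n n a)).compAlternatingMap (xProd n n))
  have h2 := key ((volCoeff n ∘ₗ LinearMap.mulLeft ℝ (xProd n n fun i => Pi.single i 1)).compAlternatingMap
    (xiProd n n))
  simp only [LinearMap.compAlternatingMap_apply, LinearMap.comp_apply, LinearMap.mulRight_apply,
    LinearMap.mulLeft_apply] at h1 h2
  rw [h, map_smul, smul_eq_mul, h1, h2]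
  ring

theorem exists_orthonormal_complement {n m p : ℕ} (hn : m + p = n) (β : Fin p → Fin n → ℝ) :
    ∃ α : Fin m → Fin n → ℝ, (∀ i j, α i ⬝ᵥ β j = 0) ∧
      (Matrix.of α) * (Matrix.of α).transpose = 1 := by
  set K : Submodule ℝ (Space n) := Submodule.span ℝ (range fun j => WithLp.toLp 2 (β j)) with hK
  have hfr : m ≤ Module.finrank ℝ Kᗮ := by
    have h1 := K.finrank_add_finrank_orthogonal
    have h2 : Module.finrank ℝ K ≤ p := by
      have := finrank_range_le_card (R := ℝ) (fun j => WithLp.toLp 2 (β j) : Fin p → Space n)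
      rwa [Fintype.card_fin] at this
    have h3 : Module.finrank ℝ (Space n) = n := by simp
    omega
  -- The `β j` may be dependent, so `Kᗮ` may have dimension larger than `m`; only the first `m`
  -- basis vectors are kept.
  let b := stdOrthonormalBasis ℝ Kᗮ
  refine ⟨fun i => ((b (Fin.castLE hfr i) : Kᗮ) : Space n).ofLp, fun i j => ?_, ?_⟩
  · have h := (b (Fin.castLE hfr i)).2
    have h' := (Submodule.mem_orthogonal _ _).1 h (WithLp.toLp 2 (β j)) (Submodule.subset_span ⟨j, rfl⟩)
    simpa [EuclideanSpace.inner_eq_star_dotProduct] using h'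
  · ext i j
    have h := (orthonormal_iff_ite.1 b.orthonormal) (Fin.castLE hfr i) (Fin.castLE hfr j)
    rw [Submodule.coe_inner, EuclideanSpace.inner_eq_star_dotProduct] at h
    rw [Matrix.mul_apply, Matrix.one_apply]
    simp only [Fin.castLE_inj] at h
    rw [← h]
    exact Finset.sum_congr rfl fun k _ => mul_comm _ _

/-- Take `α` orthonormal and orthogonal to `β`. The product of the stacked matrix `(α; γ)` with the
transpose of `(α; β)` is block triangular with diagonal blocks `1` and `γ βᵀ`, so `c = det (α; β)`
works for every `γ`. This turns the wedge pairing into an inner product of Plücker vectors. -/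
theorem exists_det_mul_transpose_eq {n m p : ℕ} (hn : m + p = n) (β : Fin p → Fin n → ℝ) :
    ∃ (α : Fin m → Fin n → ℝ) (c : ℝ), ∀ γ : Fin p → Fin n → ℝ,
      (Matrix.of γ * (Matrix.of β).transpose).det =
        c * (Matrix.of fun i => Fin.append α γ (Fin.cast hn.symm i)).det := by
  subst hn
  obtain ⟨α, h1, h2⟩ := exists_orthonormal_complement rfl β
  refine ⟨α, (Matrix.of (Fin.append α β)).det, fun γ => ?_⟩
  have : ((Matrix.of (Fin.append α γ)) * (Matrix.of (Fin.append α β)).transpose).submatrix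
      finSumFinEquiv finSumFinEquiv = Matrix.fromBlocks 1 0
        (Matrix.of γ * (Matrix.of α).transpose) (Matrix.of γ * (Matrix.of β).transpose) := by
    rw [← h2]
    ext i j
    rcases i with i | i <;> rcases j with j | j
    · simp [Matrix.mul_apply]
    · simpa [Matrix.mul_apply, dotProduct] using h1 i j
    · simp [Matrix.mul_apply]
    · simp [Matrix.mul_apply]
  have h3 := congrArg Matrix.det this
  rw [Matrix.det_submatrix_equiv_self, Matrix.det_mul, Matrix.det_transpose,
    Matrix.det_fromBlocks_zero₁₂, Matrix.det_one, one_mul] at h3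
  rw [← h3, mul_comm]
  rfl

/-! ### Symmetric forms are combinations of elementary and weakly null ones -/

/-- Let `dᵢ` be the vector of `p × p` minors of `βᵢ`. Up to `p!`, the Gram determinant of `βᵢ` and
`βⱼ` is `⟨dᵢ, dⱼ⟩`, whose square is the inner product of `dᵢ ⊗ dᵢ` and `dⱼ ⊗ dⱼ`. The hypothesis
thus makes `∑ cᵢ dᵢ ⊗ dᵢ` orthogonal to itself, and the form in question is a linear image of this
tensor. -/
theorem sum_smul_eq_zero_of_sum_det_sq_eq_zero {n p N : ℕ} (c : Fin N → ℝ)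
    (β : Fin N → Fin p → Fin n → ℝ)
    (h : ∀ γ : Fin p → Fin n → ℝ,
      ∑ i, c i * (Matrix.of γ * (Matrix.of (β i)).transpose).det ^ 2 = 0) :
    ∑ i, c i • (xProd n p (β i) * xiProd n p (β i)) = 0 := by
  set d : Fin N → (Fin p → Fin n) → ℝ := fun i f => Matrix.det (Matrix.of fun a b => β i a (f b))
    with hd
  have hp : (p.factorial : ℝ) ≠ 0 := Nat.cast_ne_zero.2 p.factorial_ne_zero
  have hdet : ∀ i j, (p.factorial : ℝ) * (Matrix.of (β i) * (Matrix.of (β j)).transpose).det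
      = ∑ f, d i f * d j f := by
    intro i j
    have := factorial_smul_alternatingMap_apply (Matrix.detRowAlternating.compLinearMap
      (Matrix.mulVecLin (Matrix.of (β j)))) (β i)
    simp only [AlternatingMap.compLinearMap_apply, smul_eq_mul, Matrix.mulVecLin_apply] at this
    have e1 : Matrix.of (β i) * (Matrix.of (β j)).transpose =
        fun a => Matrix.mulVec (Matrix.of (β j)) (β i a) := by
      ext a b
      simp [Matrix.mul_apply, Matrix.mulVec, dotProduct, mul_comm]
    rw [e1]
    refine this.trans (Finset.sum_congr rfl fun f _ => ?_)
    rw [hd]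
    simp only
    rw [← Matrix.det_transpose (Matrix.of fun a b => β j a _)]
    congr 2
    ext a b
    simp
  -- Take `γ = βⱼ` in the hypothesis, multiply by `cⱼ` and sum over `j`.
  have hsq : ∑ f, ∑ g, (∑ i, c i * (d i f * d i g)) ^ 2 = 0 := by
    have h1 : ∀ j, ∑ i, c i * ∑ f, ∑ g, (d i f * d i g) * (d j f * d j g) = 0 := by
      intro j
      have h2 := congrArg (fun t => (p.factorial : ℝ) ^ 2 * t) (h (β j))
      simp only [Finset.mul_sum, mul_zero] at h2
      rw [← h2]
      refine Finset.sum_congr rfl fun i _ => ?_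
      have h3 := hdet j i
      rw [mul_left_comm, ← mul_pow, h3, sq, Finset.sum_mul_sum]
      congr 1
      refine Finset.sum_congr rfl fun f _ => Finset.sum_congr rfl fun g _ => by ring
    calc ∑ f, ∑ g, (∑ i, c i * (d i f * d i g)) ^ 2
        = ∑ f, ∑ g, ∑ j, ∑ i, c j * (c i * ((d i f * d i g) * (d j f * d j g))) := by
          refine Finset.sum_congr rfl fun f _ => Finset.sum_congr rfl fun g _ => ?_
          rw [sq, Finset.sum_mul_sum, Finset.sum_comm]
          exact Finset.sum_congr rfl fun j _ => Finset.sum_congr rfl fun i _ => by ring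
      _ = ∑ j, c j * ∑ i, c i * ∑ f, ∑ g, (d i f * d i g) * (d j f * d j g) := by
          simp only [Finset.mul_sum]
          rw [Finset.sum_congr rfl fun f _ => Finset.sum_comm, Finset.sum_comm]
          refine Finset.sum_congr rfl fun j _ => ?_
          rw [Finset.sum_congr rfl fun f _ => Finset.sum_comm, Finset.sum_comm]
      _ = 0 := by simp [h1]
  have hzero : ∀ f g, ∑ i, c i * (d i f * d i g) = 0 := by
    intro f g
    have h1 := (Finset.sum_eq_zero_iff_of_nonneg fun f _ => Finset.sum_nonneg fun g _ =>
      sq_nonneg _).1 hsq f (Finset.mem_univ _)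
    have h2 := (Finset.sum_eq_zero_iff_of_nonneg fun g _ => sq_nonneg _).1 h1 g (Finset.mem_univ _)
    exact pow_eq_zero_iff two_ne_zero |>.1 h2
  have hfin : ((p.factorial : ℝ) * p.factorial) •
      ∑ i, c i • (xProd n p (β i) * xiProd n p (β i)) = 0 := by
    have h1 : ∀ i, ((p.factorial : ℝ) * p.factorial) • (xProd n p (β i) * xiProd n p (β i)) =
        ∑ f, ∑ g, (d i f * d i g) • (xProd n p (fun j => Pi.single (f j) 1) *
          xiProd n p fun j => Pi.single (g j) 1) := by
      intro i
      rw [← smul_mul_smul_comm, factorial_smul_alternatingMap_apply,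
        factorial_smul_alternatingMap_apply, Finset.sum_mul_sum]
      refine Finset.sum_congr rfl fun f _ => Finset.sum_congr rfl fun g _ => ?_
      rw [smul_mul_smul_comm]
    rw [Finset.smul_sum]
    simp only [smul_comm _ (c _), h1, Finset.smul_sum, smul_smul]
    rw [Finset.sum_comm]
    refine Finset.sum_eq_zero fun f _ => ?_
    rw [Finset.sum_comm]
    refine Finset.sum_eq_zero fun g _ => ?_
    rw [← Finset.sum_smul, hzero, zero_smul]
  exact (smul_eq_zero.1 hfin).resolve_left (mul_ne_zero hp hp)

/-- Write `θ` as a combination of elementary forms built from tuples `βᵢ`. For a given `γ`, wedging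
with the elementary form of an orthonormal `α` orthogonal to `γ` produces multiples of `det (α;
βᵢ)²`, which determine the squared Gram determinants of `γ` and `βᵢ`. The preceding sum-of-squares
lemma then applies. -/
theorem eq_zero_of_mem_span_isElementary {n m p : ℕ} (hn : m + p = n) {θ : Alg n}
    (hθ : θ ∈ Submodule.span ℝ {F | IsElementary p F})
    (h : ∀ E, IsElementary m E → volCoeff n (E * θ) = 0) : θ = 0 := by
  obtain ⟨N, c, F, rfl⟩ := Submodule.mem_span_set'.1 hθ
  choose β hβ using fun i => isElementary_iff.1 (F i).2
  obtain ⟨s, hs, hprod⟩ := exists_prod_eq_smul_xProd_mul_xiProd n p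
  obtain ⟨v, hv, hvol⟩ := exists_volCoeff_prod_eq n
  have hF : ∀ i, (F i : Alg n) = s • (xProd n p (β i) * xiProd n p (β i)) := fun i => by
    rw [hβ, hprod]
  simp only [hF, smul_comm _ s]
  rw [← Finset.smul_sum, sum_smul_eq_zero_of_sum_det_sq_eq_zero c β, smul_zero]
  intro γ
  obtain ⟨α, k, hα⟩ := exists_det_mul_transpose_eq hn γ
  have h1 := h _ (isElementary_iff.2 ⟨α, rfl⟩)
  have h2 : ∀ i, volCoeff n ((List.ofFn fun j => xForm (α j) * xiForm (α j)).prod * F i) =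
      v * (Matrix.of fun j => Fin.append α (β i) (Fin.cast hn.symm j)).det ^ 2 := by
    intro i
    rw [← hvol, hβ, ← List.prod_append, ← List.ofFn_fin_append]
    subst hn
    congr 2
    refine congrArg List.ofFn (funext fun j => ?_)
    refine Fin.addCases (fun i => ?_) (fun i => ?_) j <;> simp
  simp only [Finset.mul_sum, map_sum, mul_smul_comm, map_smul, smul_eq_mul, h2] at h1
  have h3 : ∀ i, (Matrix.of γ * (Matrix.of (β i)).transpose).det ^ 2 =
      k ^ 2 * (Matrix.of fun j => Fin.append α (β i) (Fin.cast hn.symm j)).det ^ 2 := by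
    intro i
    rw [← mul_pow, ← hα, ← Matrix.det_transpose, Matrix.transpose_mul, Matrix.transpose_transpose]
  have h4 : v * ∑ i, c i * (Matrix.of fun j => Fin.append α (β i) (Fin.cast hn.symm j)).det ^ 2 = 0 := by
    rw [← h1, Finset.mul_sum]
    exact Finset.sum_congr rfl fun i _ => by ring
  have h5 := (mul_eq_zero.1 h4).resolve_left hv
  calc _ = k ^ 2 * ∑ i, c i * (Matrix.of fun j => Fin.append α (β i) (Fin.cast hn.symm j)).det ^ 2 := by
        rw [Finset.mul_sum]
        exact Finset.sum_congr rfl fun i _ => by rw [h3]; ring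
    _ = 0 := by rw [h5, mul_zero]

theorem mem_weaklyNull_iff {n m p : ℕ} (hn : m + p = n) {η : Alg n} :
    η ∈ weaklyNull n m ↔
      η ∈ symmetricForms n m ∧ ∀ E, IsElementary p E → volCoeff n (η * E) = 0 := by
  constructor
  · rintro ⟨h1, h2⟩
    refine ⟨h1.1, fun E hE => le_antisymm ?_ (h1.2 p hn E hE)⟩
    have := h2.2 p hn E hE
    rwa [neg_mul, map_neg, Left.nonneg_neg_iff] at this
  · rintro ⟨h1, h2⟩
    refine ⟨⟨h1, fun q hq E hE => ?_⟩, ⟨⟨neg_mem h1.1, by rw [map_neg, h1.2]⟩, fun q hq E hE => ?_⟩⟩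
    · obtain rfl : q = p := by omega
      exact (h2 E hE).ge
    · obtain rfl : q = p := by omega
      rw [neg_mul, map_neg, h2 E hE, neg_zero]

/-- Symmetric forms, as a subspace. -/
def symmetricSubmodule (n m : ℕ) : Submodule ℝ (Alg n) where
  carrier := symmetricForms n m
  add_mem' ha hb := ⟨add_mem ha.1 hb.1, by rw [map_add, ha.2, hb.2]⟩
  zero_mem' := ⟨zero_mem _, map_zero _⟩
  smul_mem' c _ ha := ⟨Submodule.smul_mem _ c ha.1, by rw [map_smul, ha.2]⟩

/-- By duality. A functional that kills weakly null forms is, on symmetric forms, the pairing with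
some `θ` in the span of elementary `(p, p)`-forms. If it also kills elementary `(m, m)`-forms, then
`θ = 0` by nondegeneracy. -/
theorem symmetricForms_subset_span {n m p : ℕ} (hn : m + p = n) :
    symmetricForms n m ⊆ (Submodule.span ℝ {E | IsElementary m E} ⊔
      Submodule.span ℝ (weaklyNull n m) : Submodule ℝ (Alg n)) := by
  intro η hη
  by_contra hcon
  obtain ⟨ℓ, hℓη, hℓ⟩ := Submodule.exists_le_ker_of_notMem hcon
  set S := symmetricSubmodule n m
  set pair : Alg n →ₗ[ℝ] Module.Dual ℝ S :=
    ((LinearMap.mul ℝ (Alg n)).compr₂ (volCoeff n) ∘ₗ S.subtype).flip with hpair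
  have pair_apply : ∀ θ (x : S), pair θ x = volCoeff n (x * θ) := fun θ x => rfl
  set W := (Submodule.span ℝ {F : Alg n | IsElementary p F}).map pair with hW
  -- In finite dimension `W` is the annihilator of its coannihilator, and the latter consists
  -- exactly of the weakly null forms.
  have hmem : ℓ ∘ₗ S.subtype ∈ W := by
    rw [← Subspace.dualCoannihilator_dualAnnihilator_eq (W := W), Submodule.mem_dualAnnihilator]
    intro x hx
    rw [Submodule.mem_dualCoannihilator] at hx
    refine hℓ (Submodule.mem_sup_right (Submodule.subset_span ?_))
    refine (mem_weaklyNull_iff hn).2 ⟨x.2, fun E hE => ?_⟩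
    exact hx (pair E) ⟨E, Submodule.subset_span hE, rfl⟩
  obtain ⟨θ, hθ, hθℓ⟩ := hmem
  have h0 : θ = 0 := by
    refine eq_zero_of_mem_span_isElementary hn hθ fun E hE => ?_
    have h1 := congrArg (fun f => f ⟨E, hE.mem_symmetricForms⟩) hθℓ
    rw [pair_apply] at h1
    exact h1.trans (hℓ (Submodule.mem_sup_left (Submodule.subset_span hE)))
  have h1 := congrArg (fun f => f ⟨η, hη⟩) hθℓ
  rw [h0, map_zero] at h1
  exact hℓη h1.symm

/-- Forms of all bidegrees are combinations of elementary `(m, m)`-forms, weakly null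
`(m, m)`-forms, antisymmetric `(m, m)`-forms and forms of other bidegrees. -/
theorem eq_top_of_isElementary_mem {n m p : ℕ} (hn : m + p = n) (V : Submodule ℝ (Alg n))
    (h1 : ∀ E, IsElementary m E → E ∈ V) (h2 : ∀ η ∈ weaklyNull n m, η ∈ V)
    (h3 : ∀ η ∈ bidegree n m m, J n η = -η → η ∈ V)
    (h4 : ∀ a b, ¬(a = m ∧ b = m) → bidegree n a b ≤ V) : V = ⊤ := by
  rw [eq_top_iff, ← iSup_bidegree n, iSup_le_iff]
  rintro ⟨a, b⟩
  by_cases hab : a = m ∧ b = m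
  · obtain ⟨rfl, rfl⟩ := hab
    intro η hη
    have hJJ : J n (J n η) = η := by
      rw [J_J_of_mem_bidegree hη, ← two_mul, pow_mul]; simp
    have e1 : (1 / 2 : ℝ) • (η + J n η) ∈ V := by
      have : (1 / 2 : ℝ) • (η + J n η) ∈ symmetricForms n b :=
        ⟨Submodule.smul_mem _ _ (add_mem hη (J_mem_bidegree hη)), by
          rw [map_smul, map_add, hJJ, add_comm]⟩
      refine (sup_le ?_ ?_ : _ ≤ V) (symmetricForms_subset_span hn this) <;> rw [Submodule.span_le]
      · exact h1
      · exact h2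
    have e2 : (1 / 2 : ℝ) • (η - J n η) ∈ V :=
      h3 _ (Submodule.smul_mem _ _ (sub_mem hη (J_mem_bidegree hη))) (by
        rw [map_smul, map_sub, hJJ, ← smul_neg, neg_sub])
    have : η = (1 / 2 : ℝ) • (η + J n η) + (1 / 2 : ℝ) • (η - J n η) := by module
    rw [this]
    exact add_mem e1 e2
  · exact h4 a b hab

/-! ### Products with semipositive `(1, 1)`-forms -/

/-- The even factor `α ∧ α^#` commutes past `η` and is absorbed into the elementary form against
which `η` is tested. -/
theorem mul_mem_weaklyNull {n m : ℕ} {a : Fin n → ℝ} {η : Alg n} (hη : η ∈ weaklyNull n m)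
    (hm : m + 1 ≤ n) : (xForm a * xiForm a) * η ∈ weaklyNull n (m + 1) := by
  obtain ⟨p, rfl⟩ := Nat.exists_eq_add_of_le hm
  rw [mem_weaklyNull_iff (p := p) rfl]
  rw [mem_weaklyNull_iff (p := 1 + p) (by ring)] at hη
  have hsym := mul_mem_symmetricForms (xForm_mul_xiForm_mem_symmetricForms a) hη.1
  rw [add_comm 1 m] at hsym
  refine ⟨hsym, fun E hE => ?_⟩
  rw [(commute_xForm_mul_xiForm a a η).eq, mul_assoc]
  exact hη.2 _ (isElementary_mul (isElementary_one a) hE)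

theorem add_mem_weaklyNull {n m : ℕ} {η θ : Alg n} (hη : η ∈ weaklyNull n m)
    (hθ : θ ∈ weaklyNull n m) : η + θ ∈ weaklyNull n m := by
  have key : ∀ {η θ : Alg n}, η ∈ weaklyPositive n m → θ ∈ weaklyPositive n m →
      η + θ ∈ weaklyPositive n m := fun hη hθ =>
    ⟨(symmetricSubmodule n m).add_mem hη.1 hθ.1, fun p hp E hE => by
      rw [add_mul, map_add]; exact add_nonneg (hη.2 p hp E hE) (hθ.2 p hp E hE)⟩
  exact ⟨key hη.1 hθ.1, by rw [neg_add]; exact key hη.2 hθ.2⟩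

theorem zero_mem_weaklyNull (n m : ℕ) : (0 : Alg n) ∈ weaklyNull n m := by
  have : (0 : Alg n) ∈ weaklyPositive n m :=
    ⟨(symmetricSubmodule n m).zero_mem, fun p hp E hE => by simp⟩
  exact ⟨this, by rwa [neg_zero]⟩

theorem smul_mem_weaklyNull {n m : ℕ} (c : ℝ) {η : Alg n} (hη : η ∈ weaklyNull n m) :
    c • η ∈ weaklyNull n m := by
  have key : ∀ {c : ℝ}, 0 ≤ c → ∀ {η : Alg n}, η ∈ weaklyPositive n m →
      c • η ∈ weaklyPositive n m := fun {c} hc {η} hη =>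
    ⟨(symmetricSubmodule n m).smul_mem c hη.1, fun p hp E hE => by
      rw [smul_mul_assoc, map_smul]; exact mul_nonneg hc (hη.2 p hp E hE)⟩
  rcases le_total 0 c with hc | hc
  · exact ⟨key hc hη.1, by rw [← smul_neg]; exact key hc hη.2⟩
  · refine ⟨?_, ?_⟩
    · rw [← neg_smul_neg]; exact key (neg_nonneg.2 hc) hη.2
    · rw [← neg_smul]; exact key (neg_nonneg.2 hc) hη.1

theorem IsElementary.mem_stronglyPositive {n m : ℕ} {E : Alg n} (hE : IsElementary m E) :
    E ∈ stronglyPositive n m :=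
  subset_closure ⟨1, fun _ => 1, fun _ => E, fun _ => one_pos, fun _ => hE, by simp⟩

theorem zero_mem_stronglyPositive (n m : ℕ) : (0 : Alg n) ∈ stronglyPositive n m :=
  subset_closure ⟨0, Fin.elim0, Fin.elim0, fun i => i.elim0, fun i => i.elim0, by simp⟩

theorem add_mem_stronglyPositive {n m : ℕ} {σ τ : Alg n} (hσ : σ ∈ stronglyPositive n m)
    (hτ : τ ∈ stronglyPositive n m) : σ + τ ∈ stronglyPositive n m := by
  refine map_mem_closure₂ continuous_add hσ hτ ?_
  rintro _ ⟨N, c, E, hc, hE, rfl⟩ _ ⟨N', c', E', hc', hE', rfl⟩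
  refine ⟨N + N', Fin.append c c', Fin.append E E', fun i => ?_, fun i => ?_, ?_⟩
  · refine Fin.addCases (fun i => ?_) (fun i => ?_) i <;> simp [hc, hc']
  · refine Fin.addCases (fun i => ?_) (fun i => ?_) i <;> simp [hE, hE']
  · simp [Fin.sum_univ_add]

theorem smul_mem_stronglyPositive {n m : ℕ} {c : ℝ} (hc : 0 ≤ c) {σ : Alg n}
    (hσ : σ ∈ stronglyPositive n m) : c • σ ∈ stronglyPositive n m := by
  -- The generating combinations have strictly positive coefficients, so `c = 0` is treated apart:
  -- zero is the empty combination.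
  rcases hc.eq_or_lt with rfl | hc
  · rw [zero_smul]; exact zero_mem_stronglyPositive n m
  · refine map_mem_closure (continuous_const_smul c) hσ ?_
    rintro _ ⟨N, d, E, hd, hE, rfl⟩
    exact ⟨N, fun i => c * d i, E, fun i => mul_pos hc (hd i), hE, by
      simp [Finset.smul_sum, smul_smul]⟩

theorem mul_mem_stronglyPositive {n m : ℕ} (a : Fin n → ℝ) {σ : Alg n}
    (hσ : σ ∈ stronglyPositive n m) :
    (xForm a * xiForm a) * σ ∈ stronglyPositive n (m + 1) := by
  refine map_mem_closure (wedgeCLM n (xForm a * xiForm a)).continuous hσ ?_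
  rintro _ ⟨N, d, E, hd, hE, rfl⟩
  refine ⟨N, d, fun i => (xForm a * xiForm a) * E i, hd, fun i => ?_, ?_⟩
  · rw [add_comm]; exact isElementary_mul (isElementary_one a) (hE i)
  · simp [Finset.mul_sum]

/-! ### Calculus of superforms -/

theorem differentiable_of_contDiff {n : ℕ} {F : Type*} [NormedAddCommGroup F] [NormedSpace ℝ F]
    {α : Space n → F} (h : ContDiff ℝ ∞ α) : Differentiable ℝ α :=
  h.differentiable (by simp)

theorem fderiv_mul_apply {n : ℕ} {α β : Space n → Alg n} (hα : ContDiff ℝ ∞ α)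
    (hβ : ContDiff ℝ ∞ β) (x v : Space n) :
    fderiv ℝ (fun y => α y * β y) x v = fderiv ℝ α x v * β x + α x * fderiv ℝ β x v := by
  have h := (wedgeCLM n).hasFDerivAt_of_bilinear (differentiable_of_contDiff hα x).hasFDerivAt
    (differentiable_of_contDiff hβ x).hasFDerivAt
  have h' : HasFDerivAt (fun y => α y * β y) _ x := h
  rw [h'.fderiv]
  simp [wedgeCLM_apply, add_comm]

theorem fderiv_linearMap_comp_apply {n : ℕ} {F G : Type*} [NormedAddCommGroup F] [NormedSpace ℝ F]
    [FiniteDimensional ℝ F] [NormedAddCommGroup G] [NormedSpace ℝ G] (L : F →ₗ[ℝ] G)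
    {α : Space n → F} (hα : ContDiff ℝ ∞ α) (x v : Space n) :
    fderiv ℝ (fun y => L (α y)) x v = L (fderiv ℝ α x v) := by
  have h := L.toContinuousLinearMap.hasFDerivAt.comp x (differentiable_of_contDiff hα x).hasFDerivAt
  have h' : HasFDerivAt (fun y => L (α y)) _ x := h
  rw [h'.fderiv]
  rfl

theorem contDiff_linearMap_comp {n : ℕ} {F G : Type*} [NormedAddCommGroup F] [NormedSpace ℝ F]
    [FiniteDimensional ℝ F] [NormedAddCommGroup G] [NormedSpace ℝ G] (L : F →ₗ[ℝ] G)
    {α : Space n → F} (hα : ContDiff ℝ ∞ α) : ContDiff ℝ ∞ fun y => L (α y) :=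
  L.toContinuousLinearMap.contDiff.comp hα

theorem contDiff_algebraMap {n : ℕ} {f : Space n → ℝ} (hf : ContDiff ℝ ∞ f) :
    ContDiff ℝ ∞ fun x => algebraMap ℝ (Alg n) (f x) :=
  contDiff_linearMap_comp (Algebra.linearMap ℝ (Alg n)) hf

theorem fderiv_fderiv_comm {n : ℕ} {F : Type*} [NormedAddCommGroup F] [NormedSpace ℝ F]
    {α : Space n → F} (hα : ContDiff ℝ ∞ α) (x v w : Space n) :
    fderiv ℝ (fun y => fderiv ℝ α y v) x w = fderiv ℝ (fun y => fderiv ℝ α y w) x v := by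
  have hd : DifferentiableAt ℝ (fderiv ℝ α) x :=
    differentiable_of_contDiff (hα.fderiv_right (m := ∞) (by simp)) x
  have key : ∀ v w, fderiv ℝ (fun y => fderiv ℝ α y v) x w = fderiv ℝ (fderiv ℝ α) x w v := by
    intro v w
    have h : HasFDerivAt (fun y => fderiv ℝ α y v) _ x := hd.hasFDerivAt.clm_apply (hasFDerivAt_const v x)
    rw [h.fderiv]
    simp
  rw [key, key]
  exact (hα.contDiffAt.isSymmSndFDerivAt (by
    rw [minSmoothness_of_isRCLikeNormedField]; exact WithTop.coe_le_coe.2 (le_top (a := (2 : ℕ∞))))).eq w v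

theorem fderiv_sum_mul_apply {n : ℕ} (c : Fin n → Alg n) {α : Fin n → Space n → Alg n}
    (hα : ∀ j, ContDiff ℝ ∞ (α j)) (x v : Space n) :
    fderiv ℝ (fun y => ∑ j, c j * α j y) x v = ∑ j, c j * fderiv ℝ (α j) x v := by
  rw [fderiv_fun_sum fun j _ => differentiable_of_contDiff (contDiff_wedge contDiff_const (hα j)) x]
  rw [sum_apply]
  exact Finset.sum_congr rfl fun j _ =>
    fderiv_linearMap_comp_apply (LinearMap.mulLeft ℝ (c j)) (hα j) x v

theorem dx_mul_dx {n : ℕ} (i j : Fin n) : dx i * dx j = -(dx j * dx i) := by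
  simpa only [xForm_single] using xForm_mul_xForm (Pi.single i 1) (Pi.single j 1)

theorem dxi_mul_dx {n : ℕ} (i j : Fin n) : dxi i * dx j = -(dx j * dxi i) := by
  simpa only [xForm_single, xiForm_single] using xiForm_mul_xForm (Pi.single i 1) (Pi.single j 1)

theorem extD_extD {n : ℕ} {α : Space n → Alg n} (hα : ContDiff ℝ ∞ α) (x : Space n) :
    extD (extD α) x = 0 := by
  have h1 : extD (extD α) x = ∑ i, ∑ j, dx i * dx j *
      fderiv ℝ (fun y => fderiv ℝ α y (EuclideanSpace.single j 1)) x (EuclideanSpace.single i 1) := by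
    refine Finset.sum_congr rfl fun i _ => ?_
    rw [show extD α = fun y => ∑ j, dx j * fderiv ℝ α y (EuclideanSpace.single j 1) from rfl,
      fderiv_sum_mul_apply _ (fun j => contDiff_fderiv_single hα j), Finset.mul_sum]
    simp only [mul_assoc]
  have h2 : extD (extD α) x = -extD (extD α) x := by
    conv_lhs => rw [h1, Finset.sum_comm]
    rw [h1, ← Finset.sum_neg_distrib]
    refine Finset.sum_congr rfl fun i _ => ?_
    rw [← Finset.sum_neg_distrib]
    refine Finset.sum_congr rfl fun j _ => ?_
    rw [fderiv_fderiv_comm hα, dx_mul_dx, neg_mul]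
  have h3 : (2 : ℝ) • extD (extD α) x = 0 := by
    rw [two_smul]
    nth_rewrite 1 [h2]
    exact neg_add_cancel _
  exact (smul_eq_zero.1 h3).resolve_left two_ne_zero

theorem extDSharp_algebraMap {n : ℕ} {f : Space n → ℝ} (hf : ContDiff ℝ ∞ f) (x : Space n) :
    extDSharp (fun y => algebraMap ℝ (Alg n) (f y)) x =
      ∑ k, dxi k * algebraMap ℝ (Alg n) (fderiv ℝ f x (EuclideanSpace.single k 1)) := by
  refine Finset.sum_congr rfl fun k _ => ?_
  congr 1
  exact fderiv_linearMap_comp_apply (Algebra.linearMap ℝ (Alg n)) hf x _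

theorem contDiff_fderiv_single_real {n : ℕ} {f : Space n → ℝ} (h : ContDiff ℝ ∞ f) (j : Fin n) :
    ContDiff ℝ ∞ fun x => fderiv ℝ f x (EuclideanSpace.single j 1) :=
  (h.fderiv_right (m := ∞) (by simp)).clm_apply contDiff_const

/-- The matrix of second derivatives. -/
noncomputable def hessian {n : ℕ} (f : Space n → ℝ) (x : Space n) : Matrix (Fin n) (Fin n) ℝ :=
  Matrix.of fun j k => fderiv ℝ (fun y => fderiv ℝ f y (EuclideanSpace.single k 1)) x
    (EuclideanSpace.single j 1)

theorem ddSharp_eq_sum {n : ℕ} {f : Space n → ℝ} (hf : ContDiff ℝ ∞ f) (x : Space n) :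
    ddSharp f x = ∑ j, ∑ k, hessian f x j k • (dx j * dxi k) := by
  rw [ddSharp, extD]
  refine Finset.sum_congr rfl fun j _ => ?_
  rw [show (extDSharp fun y => algebraMap ℝ (Alg n) (f y)) = fun y => ∑ k, dxi k *
    algebraMap ℝ (Alg n) (fderiv ℝ f y (EuclideanSpace.single k 1)) from
      funext (extDSharp_algebraMap hf),
    fderiv_sum_mul_apply _ fun k => contDiff_algebraMap (contDiff_fderiv_single_real hf k),
    Finset.mul_sum]
  refine Finset.sum_congr rfl fun k _ => ?_
  have := fderiv_linearMap_comp_apply (Algebra.linearMap ℝ (Alg n)) (contDiff_fderiv_single_real hf k)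
    x (EuclideanSpace.single j 1)
  simp only [Algebra.linearMap_apply] at this
  rw [this, ← mul_assoc, ← Algebra.commutes, ← Algebra.smul_def]
  rfl

theorem commute_ddSharp {n : ℕ} {f : Space n → ℝ} (hf : ContDiff ℝ ∞ f) (x : Space n) (η : Alg n) :
    Commute (ddSharp f x) η := by
  rw [ddSharp_eq_sum hf]
  refine Finset.sum_induction _ (Commute · η) (fun _ _ h h' => h.add_left h') (Commute.zero_left η)
    fun j _ => ?_
  refine Finset.sum_induction _ (Commute · η) (fun _ _ h h' => h.add_left h') (Commute.zero_left η)
    fun k _ => Commute.smul_left ?_ _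
  simpa only [xForm_single, xiForm_single] using
    commute_xForm_mul_xiForm (Pi.single j 1) (Pi.single k 1) η

/-- The form `dd^#f` is `d`-closed and even, so the Leibniz rule leaves one term and no sign. This
is what keeps products with `dd^#f` closed. -/
theorem extD_ddSharp_mul {n : ℕ} {f : Space n → ℝ} (hf : ContDiff ℝ ∞ f) {χ : Space n → Alg n}
    (hχ : ContDiff ℝ ∞ χ) (x : Space n) :
    extD (fun y => ddSharp f y * χ y) x = ddSharp f x * extD χ x := by
  have h0 : extD (ddSharp f) x = 0 := extD_extD (contDiff_extDSharp (contDiff_algebraMap hf)) x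
  have h1 : extD (fun y => ddSharp f y * χ y) x = extD (ddSharp f) x * χ x +
      ddSharp f x * extD χ x := by
    unfold extD
    rw [Finset.sum_mul, Finset.mul_sum, ← Finset.sum_add_distrib]
    refine Finset.sum_congr rfl fun j _ => ?_
    rw [fderiv_mul_apply (contDiff_ddSharp hf) hχ, mul_add, ← mul_assoc, ← mul_assoc, ← mul_assoc,
      (commute_ddSharp hf x (dx j)).eq]
  rw [h1, h0, zero_mul, zero_add]

theorem extD_extDSharp_mul {n : ℕ} {f : Space n → ℝ} (hf : ContDiff ℝ ∞ f) {χ : Space n → Alg n}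
    (hχ : ContDiff ℝ ∞ χ) (x : Space n) :
    extD (fun y => extDSharp (fun z => algebraMap ℝ (Alg n) (f z)) y * χ y) x =
      ddSharp f x * χ x - extDSharp (fun z => algebraMap ℝ (Alg n) (f z)) x * extD χ x := by
  rw [ddSharp, sub_eq_add_neg, ← mul_neg]
  unfold extD
  rw [Finset.sum_mul, ← Finset.sum_neg_distrib, Finset.mul_sum, ← Finset.sum_add_distrib]
  refine Finset.sum_congr rfl fun j _ => ?_
  rw [fderiv_mul_apply (contDiff_extDSharp (contDiff_algebraMap hf)) hχ, mul_add, ← mul_assoc,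
    ← mul_assoc, mul_neg, ← mul_assoc, ← neg_mul]
  congr 2
  rw [extDSharp_algebraMap hf, Finset.mul_sum, Finset.sum_mul, ← Finset.sum_neg_distrib]
  refine Finset.sum_congr rfl fun k _ => ?_
  rw [← Algebra.commutes, mul_assoc, ← mul_assoc, ← Algebra.commutes, mul_assoc, dxi_mul_dx, mul_neg,
    neg_neg]

theorem extDSharp_algebraMap_mul {n : ℕ} {f : Space n → ℝ} (hf : ContDiff ℝ ∞ f)
    {η : Space n → Alg n} (hη : ContDiff ℝ ∞ η) (x : Space n) :
    extDSharp (fun y => algebraMap ℝ (Alg n) (f y) * η y) x =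
      extDSharp (fun z => algebraMap ℝ (Alg n) (f z)) x * η x +
        algebraMap ℝ (Alg n) (f x) * extDSharp η x := by
  unfold extDSharp
  rw [Finset.sum_mul, Finset.mul_sum, ← Finset.sum_add_distrib]
  refine Finset.sum_congr rfl fun j _ => ?_
  rw [fderiv_mul_apply (contDiff_algebraMap hf) hη, mul_add, ← mul_assoc, ← mul_assoc, ← mul_assoc,
    Algebra.commutes]

theorem J_dx {n : ℕ} (i : Fin n) : J n (dx i) = -dxi i := by
  rw [← xForm_single, J_xForm, xiForm_single]

theorem J_extD {n : ℕ} {α : Space n → Alg n} (hα : ContDiff ℝ ∞ α) (x : Space n) :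
    J n (extD α x) = -extDSharp (fun y => J n (α y)) x := by
  unfold extD extDSharp
  rw [map_sum, ← Finset.sum_neg_distrib]
  refine Finset.sum_congr rfl fun j _ => ?_
  have := fderiv_linearMap_comp_apply (J n).toLinearMap hα x (EuclideanSpace.single j 1)
  simp only [AlgHom.toLinearMap_apply] at this
  rw [map_mul, J_dx, neg_mul, this]

/-- Thus `J³` inverts `J` on all forms, also those of mixed bidegree. -/
theorem J_J_J_J {n : ℕ} (η : Alg n) : J n (J n (J n (J n η))) = η := by
  have h : (((J n).comp (J n)).comp ((J n).comp (J n))) = AlgHom.id ℝ (Alg n) := by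
    refine ExteriorAlgebra.hom_ext ?_
    refine LinearMap.ext fun w => ?_
    simp only [J, ExteriorAlgebra.map_apply_ι, LinearMap.comp_apply, AlgHom.toLinearMap_apply,
      AlgHom.comp_apply, AlgHom.id_apply]
    congr 2
    ext k
    obtain ⟨⟨j, t⟩, rfl⟩ := toLex.surjective k
    fin_cases t <;> simp [complexStructure]
  exact DFunLike.congr_fun h η

/-! ### Convexity and the Hessian -/

/-- The quadratic form is the second derivative of the convex function `t ↦ f (x + t v)` at `0`. -/
theorem sum_hessian_nonneg {n : ℕ} {f : Space n → ℝ} (hf : ContDiff ℝ ∞ f)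
    (hc : ConvexOn ℝ univ f) (x : Space n) (v : Fin n → ℝ) :
    0 ≤ ∑ j, ∑ k, v j * hessian f x j k * v k := by
  set w : Space n := WithLp.toLp 2 v with hw
  have hsum : w = ∑ j, v j • EuclideanSpace.single j (1 : ℝ) := by
    ext i
    simp [hw, Pi.single_apply]
  have e1 : ∑ j, ∑ k, v j * hessian f x j k * v k = fderiv ℝ (fun y => fderiv ℝ f y w) x w := by
    have h1 : (fun y => fderiv ℝ f y w) =
        fun y => ∑ k, v k * fderiv ℝ f y (EuclideanSpace.single k 1) := by
      funext y
      rw [hsum, map_sum]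
      simp
    rw [h1, fderiv_fun_sum fun k _ => (differentiable_of_contDiff
      (contDiff_fderiv_single_real hf k) x).const_mul _]
    conv_rhs => rw [hsum, map_sum]
    refine Finset.sum_congr rfl fun j _ => ?_
    rw [map_smul, sum_apply, smul_eq_mul, Finset.mul_sum]
    refine Finset.sum_congr rfl fun k _ => ?_
    rw [fderiv_const_mul (differentiable_of_contDiff (contDiff_fderiv_single_real hf k) x)]
    simp only [smul_apply, smul_eq_mul, hessian, Matrix.of_apply]
    ring
  rw [e1]
  set L : ℝ → Space n := fun t => x + t • w with hL
  have hLd : ∀ t, HasDerivAt L w t := fun t => by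
    have := ((hasDerivAt_id t).smul_const w).const_add x
    rwa [one_smul] at this
  have hd1 : ∀ t, HasDerivAt (fun t => f (L t)) (fderiv ℝ f (L t) w) t := fun t =>
    (differentiable_of_contDiff hf (L t)).hasFDerivAt.comp_hasDerivAt t (hLd t)
  have hsm : ContDiff ℝ ∞ fun y => fderiv ℝ f y w :=
    (hf.fderiv_right (m := ∞) (by simp)).clm_apply contDiff_const
  have hd2 : HasDerivAt (fun t => fderiv ℝ f (L t) w) (fderiv ℝ (fun y => fderiv ℝ f y w) x w) 0 := by
    have := (differentiable_of_contDiff hsm (L 0)).hasFDerivAt.comp_hasDerivAt 0 (hLd 0)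
    have h0 : L 0 = x := by simp [hL]
    rwa [h0] at this
  have hcv : ConvexOn ℝ univ fun t => f (L t) := by
    refine ⟨convex_univ, fun s _ t _ a b ha hb hab => ?_⟩
    have := hc.2 (mem_univ (L s)) (mem_univ (L t)) ha hb hab
    refine le_trans (le_of_eq ?_) this
    simp only [hL, smul_add, smul_smul, smul_eq_mul, add_smul]
    have hx : a • x + b • x = x := by rw [← add_smul, hab, one_smul]
    rw [add_add_add_comm, hx]
  have hmono : Monotone fun t => fderiv ℝ f (L t) w := by
    have h1 := hcv.monotoneOn_deriv fun t _ => (hd1 t).differentiableAt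
    rw [funext fun t => ((hd1 t).deriv).symm]
    exact monotoneOn_univ.1 h1
  rw [← hd2.deriv]
  exact hmono.deriv_nonneg

/-- A positive semidefinite matrix is a sum of rank-one matrices `u uᵀ`, and each of these
corresponds to an elementary `(1, 1)`-form. -/
theorem exists_ddSharp_eq_sum {n : ℕ} {f : Space n → ℝ} (hf : ContDiff ℝ ∞ f)
    (hc : ConvexOn ℝ univ f) (x : Space n) :
    ∃ (m : ℕ) (u : Fin m → Fin n → ℝ), ddSharp f x = ∑ i, xForm (u i) * xiForm (u i) := by
  have hpos : (hessian f x).PosSemidef := by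
    refine Matrix.PosSemidef.of_dotProduct_mulVec_nonneg ?_ fun v => ?_
    · ext j k
      simpa [hessian] using fderiv_fderiv_comm hf x _ _
    · refine (sum_hessian_nonneg hf hc x v).trans (le_of_eq ?_)
      simp [dotProduct, Matrix.mulVec, Finset.mul_sum, mul_assoc]
  obtain ⟨m, u, hu⟩ := Matrix.posSemidef_iff_eq_sum_vecMulVec.1 hpos
  refine ⟨m, u, ?_⟩
  rw [ddSharp_eq_sum hf, hu]
  simp only [xForm_eq_sum, xiForm_eq_sum, Finset.sum_mul_sum, smul_mul_smul_comm, Matrix.sum_apply,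
    Finset.sum_smul, Matrix.vecMulVec_apply, star_trivial]
  rw [Finset.sum_congr rfl fun j _ => Finset.sum_comm, Finset.sum_comm]

/-! ### Test forms -/

theorem TestForm.wedge_apply {n : ℕ} {θ : Space n → Alg n} (hθ : ContDiff ℝ ∞ θ) (χ : TestForm n)
    (x : Space n) : TestForm.wedge θ hθ χ x = θ x * χ x := rfl

theorem TestForm.d_apply {n : ℕ} (χ : TestForm n) (x : Space n) : χ.d x = extD χ x := rfl

theorem TestForm.complexJ_apply {n : ℕ} (χ : TestForm n) (x : Space n) :
    χ.complexJ x = J n (χ x) := rfl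

/-- The operator `d^#` on test forms. -/
noncomputable def TestForm.dSharp {n : ℕ} (χ : TestForm n) : TestForm n where
  toFun := extDSharp χ
  contDiff' := contDiff_extDSharp χ.contDiff
  hasCompactSupport' := χ.hasCompactSupport.mono' fun x hx => by
    by_contra h
    exact hx (by simp [extDSharp, fderiv_of_notMem_tsupport (𝕜 := ℝ) h])
  tsupport_subset' := by simp

theorem TestForm.dSharp_apply {n : ℕ} (χ : TestForm n) (x : Space n) :
    χ.dSharp x = extDSharp χ x := rfl

theorem TestForm.tsupport_d_subset {n : ℕ} (χ : TestForm n) : tsupport χ.d ⊆ tsupport χ :=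
  closure_minimal (fun x hx => by
    by_contra h
    exact hx (by simp [TestForm.d_apply, extD, fderiv_of_notMem_tsupport (𝕜 := ℝ) h]))
    (isClosed_tsupport _)

theorem TestForm.tsupport_dSharp_subset {n : ℕ} (χ : TestForm n) : tsupport χ.dSharp ⊆ tsupport χ :=
  closure_minimal (fun x hx => by
    by_contra h
    exact hx (by simp [TestForm.dSharp_apply, extDSharp, fderiv_of_notMem_tsupport (𝕜 := ℝ) h]))
    (isClosed_tsupport _)

/-- The product of a smooth function and a test form. -/
noncomputable def TestForm.smulFun {n : ℕ} (f : Space n → ℝ) (hf : ContDiff ℝ ∞ f)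
    (χ : TestForm n) : TestForm n :=
  TestForm.wedge (fun x => algebraMap ℝ (Alg n) (f x)) (contDiff_algebraMap hf) χ

theorem TestForm.smulFun_apply {n : ℕ} {f : Space n → ℝ} (hf : ContDiff ℝ ∞ f) (χ : TestForm n)
    (x : Space n) : TestForm.smulFun f hf χ x = f x • χ x := by
  rw [Algebra.smul_def]; rfl

/-- The test form `φ η`, for a test function `φ` and a form `η` with constant coefficients. -/
noncomputable def TestForm.ofConst {n : ℕ} (φ : Space n → ℝ) (hφ : ContDiff ℝ ∞ φ)
    (hc : HasCompactSupport φ) (η : Alg n) : TestForm n where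
  toFun x := φ x • η
  contDiff' := hφ.smul contDiff_const
  hasCompactSupport' := hc.smul_right
  tsupport_subset' := by simp

theorem TestForm.ofConst_apply {n : ℕ} {φ : Space n → ℝ} (hφ : ContDiff ℝ ∞ φ)
    (hc : HasCompactSupport φ) (η : Alg n) (x : Space n) :
    TestForm.ofConst φ hφ hc η x = φ x • η := rfl

/-- The product with a smooth form as a continuous linear operator on test forms. -/
noncomputable def wedgeTestCLM {n : ℕ} (θ : Space n → Alg n) (hθ : ContDiff ℝ ∞ θ) :
    TestForm n →L[ℝ] TestForm n :=
  TestFunction.mkCLM ℝ (TestForm.wedge θ hθ)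
    (fun χ η => by ext1 x; exact mul_add _ _ _)
    (fun c χ => by ext1 x; exact mul_smul_comm c (θ x) (χ x))
    (fun _ hK => (TestFunction.continuous_ofSupportedIn hK).comp
      (ContDiffMapSupportedIn.bilinLeftCLM (wedgeCLM n).flip hθ).continuous)

/-- The product of a smooth form and a supercurrent. -/
noncomputable def wedgeCurrent {n : ℕ} (θ : Space n → Alg n) (hθ : ContDiff ℝ ∞ θ)
    (Ω : Supercurrent n) : Supercurrent n :=
  StrongDual.toWeakDual ((WeakDual.toStrongDual Ω).comp (wedgeTestCLM θ hθ))

theorem wedgeCurrent_apply {n : ℕ} {θ : Space n → Alg n} (hθ : ContDiff ℝ ∞ θ) (Ω : Supercurrent n)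
    (χ : TestForm n) : wedgeCurrent θ hθ Ω χ = Ω (TestForm.wedge θ hθ χ) := rfl

/-! ### Integration by parts -/

/-- `J` conjugates `d` into `d^#` up to sign: `d^#χ = -J d J³χ`. Symmetry of `Ω` removes the outer
`J`, and closedness does the rest. -/
theorem apply_dSharp_eq_zero {n p : ℕ} {Ω : Supercurrent n} (h : IsClosedCurrent Ω)
    (hs : IsSymmetricCurrent p Ω) (χ : TestForm n) : Ω χ.dSharp = 0 := by
  have h1 : χ.dSharp = -(χ.complexJ.complexJ.complexJ.d).complexJ := by
    ext1 x
    have h2 := J_extD χ.complexJ.complexJ.complexJ.contDiff x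
    have h3 : (fun y => J n (χ.complexJ.complexJ.complexJ y)) = χ := by
      funext y
      exact J_J_J_J _
    rw [h3] at h2
    rw [neg_apply, TestForm.complexJ_apply, TestForm.d_apply, h2, neg_neg]
    rfl
  rw [h1, map_neg, hs.2, h, neg_zero]

/-- Pointwise, `dd^#f ∧ χ = d(d^#f ∧ χ) + d^#(f dχ) - f d^#dχ`, and `Ω` annihilates the first two
terms. -/
theorem apply_wedge_ddSharp {n p : ℕ} {Ω : Supercurrent n} (h : IsClosedCurrent Ω)
    (hs : IsSymmetricCurrent p Ω) {f : Space n → ℝ} (hf : ContDiff ℝ ∞ f) (χ : TestForm n) :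
    Ω (TestForm.wedge (ddSharp f) (contDiff_ddSharp hf) χ) =
      -Ω (TestForm.smulFun f hf χ.d.dSharp) := by
  have h1 : TestForm.wedge (ddSharp f) (contDiff_ddSharp hf) χ =
      (TestForm.wedge (extDSharp fun x => algebraMap ℝ (Alg n) (f x))
        (contDiff_extDSharp (contDiff_algebraMap hf)) χ).d +
      (TestForm.smulFun f hf χ.d).dSharp - TestForm.smulFun f hf χ.d.dSharp := by
    ext1 x
    have e1 := extD_extDSharp_mul hf χ.contDiff x
    have e2 := extDSharp_algebraMap_mul hf χ.d.contDiff x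
    change ddSharp f x * χ x = extD (fun y => extDSharp (fun z => algebraMap ℝ (Alg n) (f z)) y * χ y) x
      + extDSharp (fun y => algebraMap ℝ (Alg n) (f y) * χ.d y) x
      - algebraMap ℝ (Alg n) (f x) * extDSharp χ.d x
    rw [e1, e2, TestForm.d_apply]
    abel
  rw [h1, map_sub, map_add, h, apply_dSharp_eq_zero h hs, add_zero, zero_sub]

/-! ### Positive currents are of order zero -/

/-- `κ` bounds the mass on `K` of all weakly positive strong `(p, p)`-currents. -/
def IsMassBound {n : ℕ} (p : ℕ) (K : Set (Space n)) (κ : TestForm n) : Prop :=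
  ∀ Ω : Supercurrent n, IsWeaklyPositiveCurrent p Ω → IsStrongCurrent p Ω →
    ∀ χ : TestForm n, tsupport χ ⊆ K → ∀ B : ℝ, (∀ x, ‖χ x‖ ≤ B) → |Ω χ| ≤ B * Ω κ

/-- The forms `η` with constant coefficients for which `φ ↦ ∫ Ω ∧ φ η` is bounded on `K`, uniformly
in the current `Ω`. -/
def boundedForms {n : ℕ} (p : ℕ) (K : Set (Space n)) : Submodule ℝ (Alg n) where
  carrier := {η | ∃ κ : TestForm n, ∀ Ω : Supercurrent n, IsWeaklyPositiveCurrent p Ω →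
    IsStrongCurrent p Ω → ∀ (φ : Space n → ℝ) (hφ : ContDiff ℝ ∞ φ) (hc : HasCompactSupport φ),
      tsupport φ ⊆ K → ∀ B : ℝ, (∀ x, |φ x| ≤ B) → |Ω (TestForm.ofConst φ hφ hc η)| ≤ B * Ω κ}
  add_mem' := by
    rintro η θ ⟨κ, h⟩ ⟨κ', h'⟩
    refine ⟨κ + κ', fun Ω h1 h2 φ hφ hc hK B hB => ?_⟩
    have : TestForm.ofConst φ hφ hc (η + θ) =
        TestForm.ofConst φ hφ hc η + TestForm.ofConst φ hφ hc θ := by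
      ext1 x; exact smul_add _ _ _
    rw [this, map_add, map_add, mul_add]
    exact (abs_add_le _ _).trans (add_le_add (h Ω h1 h2 φ hφ hc hK B hB) (h' Ω h1 h2 φ hφ hc hK B hB))
  zero_mem' := by
    refine ⟨0, fun Ω h1 h2 φ hφ hc hK B hB => ?_⟩
    have : TestForm.ofConst φ hφ hc (0 : Alg n) = 0 := by
      ext1 x; exact smul_zero _
    rw [this, map_zero, abs_zero, mul_zero]
  smul_mem' := by
    rintro c η ⟨κ, h⟩
    refine ⟨|c| • κ, fun Ω h1 h2 φ hφ hc hK B hB => ?_⟩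
    have : TestForm.ofConst φ hφ hc (c • η) = c • TestForm.ofConst φ hφ hc η := by
      ext1 x; exact smul_comm _ _ _
    rw [this, map_smul, map_smul, smul_eq_mul, smul_eq_mul, abs_mul, mul_left_comm]
    exact mul_le_mul_of_nonneg_left (h Ω h1 h2 φ hφ hc hK B hB) (abs_nonneg c)

theorem mem_boundedForms_of_apply_eq_zero {n p : ℕ} {K : Set (Space n)} {η : Alg n}
    (h : ∀ Ω : Supercurrent n, IsWeaklyPositiveCurrent p Ω → IsStrongCurrent p Ω →
      ∀ (φ : Space n → ℝ) (hφ : ContDiff ℝ ∞ φ) (hc : HasCompactSupport φ),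
        Ω (TestForm.ofConst φ hφ hc η) = 0) : η ∈ boundedForms p K :=
  ⟨0, fun Ω h1 h2 φ hφ hc _ B _ => by rw [h Ω h1 h2, map_zero, abs_zero, mul_zero]⟩

theorem bidegree_le_boundedForms {n p a b : ℕ} (K : Set (Space n)) (h : ¬(a + p = n ∧ b + p = n)) :
    bidegree n a b ≤ boundedForms p K := fun _ hη =>
  mem_boundedForms_of_apply_eq_zero fun _ h1 _ _ _ _ =>
    h1.1.1 a b h _ fun _ => Submodule.smul_mem _ _ hη

theorem IsElementary.mem_boundedForms {n m p : ℕ} (hn : m + p = n) {K : Set (Space n)}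
    (hK : IsCompact K) {E : Alg n} (hE : IsElementary m E) : E ∈ boundedForms p K := by
  obtain ⟨R, hR⟩ := hK.isBounded.subset_closedBall (0 : Space n)
  -- A cutoff equal to `1` on `K`; then `B ρ ± φ ≥ 0`, so `(B ρ ± φ) E` is strongly positive. The
  -- maximum with `1` keeps the inner radius positive.
  let ρ : ContDiffBump (0 : Space n) := ⟨max R 1, max R 1 + 1, by positivity, by linarith⟩
  have hρK : ∀ x ∈ K, ρ x = 1 := fun x hx =>
    ρ.one_of_mem_closedBall (Metric.closedBall_subset_closedBall (le_max_left _ _) (hR hx))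
  refine ⟨TestForm.ofConst ρ ρ.contDiff ρ.hasCompactSupport E,
    fun Ω h1 h2 φ hφ hc hφK B hB => ?_⟩
  have hB0 : 0 ≤ B := (abs_nonneg _).trans (hB 0)
  have hle : ∀ x, |φ x| ≤ B * ρ x := by
    intro x
    by_cases hx : x ∈ K
    · rw [hρK x hx, mul_one]; exact hB x
    · rw [image_eq_zero_of_notMem_tsupport fun h => hx (hφK h), abs_zero]
      exact mul_nonneg hB0 ρ.nonneg
  have e1 := h1.2 m hn (B • TestForm.ofConst ρ ρ.contDiff ρ.hasCompactSupport E -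
    TestForm.ofConst φ hφ hc E) fun x => by
      have : (B • TestForm.ofConst ρ ρ.contDiff ρ.hasCompactSupport E -
        TestForm.ofConst φ hφ hc E) x = (B * ρ x - φ x) • E := by
          rw [sub_smul, mul_smul]; rfl
      rw [this]
      exact smul_mem_stronglyPositive (sub_nonneg.2 ((le_abs_self _).trans (hle x)))
        hE.mem_stronglyPositive
  have e2 := h1.2 m hn (B • TestForm.ofConst ρ ρ.contDiff ρ.hasCompactSupport E +
    TestForm.ofConst φ hφ hc E) fun x => by
      have : (B • TestForm.ofConst ρ ρ.contDiff ρ.hasCompactSupport E +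
        TestForm.ofConst φ hφ hc E) x = (B * ρ x + φ x) • E := by
          rw [add_smul, mul_smul]; rfl
      rw [this]
      exact smul_mem_stronglyPositive (by linarith [(neg_le_abs (φ x)).trans (hle x)])
        hE.mem_stronglyPositive
  rw [map_sub, map_smul, smul_eq_mul] at e1
  rw [map_add, map_smul, smul_eq_mul] at e2
  exact abs_le.2 ⟨by linarith, by linarith⟩

/-- Positivity handles elementary forms. On weakly null forms, antisymmetric forms and wrong
bidegrees `Ω` vanishes, by strongness, symmetry and its bidegree respectively. If `p > n`, every
bidegree is wrong. -/
theorem boundedForms_eq_top {n : ℕ} (p : ℕ) {K : Set (Space n)} (hK : IsCompact K) :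
    boundedForms p K = ⊤ := by
  by_cases hp : p ≤ n
  · obtain ⟨m, hn⟩ := Nat.exists_eq_add_of_le' hp
    refine eq_top_of_isElementary_mem hn.symm _ (fun E hE => hE.mem_boundedForms hn.symm hK)
      (fun η hη => ?_) (fun η hη hJ => ?_) (fun a b hab => bidegree_le_boundedForms K (by omega))
    · exact mem_boundedForms_of_apply_eq_zero fun Ω h1 h2 φ hφ hc =>
        h2.2 m hn.symm _ fun x => smul_mem_weaklyNull _ hη
    · refine mem_boundedForms_of_apply_eq_zero fun Ω h1 h2 φ hφ hc => ?_
      have : (TestForm.ofConst φ hφ hc η).complexJ = -TestForm.ofConst φ hφ hc η := by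
        ext1 x
        rw [TestForm.complexJ_apply, TestForm.ofConst_apply, map_smul, hJ, smul_neg]
        rfl
      have h3 := h1.1.2 (TestForm.ofConst φ hφ hc η)
      rw [this, map_neg] at h3
      linarith
  · rw [eq_top_iff, ← iSup_bidegree n, iSup_le_iff]
    exact fun ab => bidegree_le_boundedForms K (by omega)

theorem exists_isMassBound {n : ℕ} (p : ℕ) {K : Set (Space n)} (hK : IsCompact K) :
    ∃ κ : TestForm n, IsMassBound p K κ := by
  have h : ∀ s, algBasis n s ∈ boundedForms p K := fun s => by
    rw [boundedForms_eq_top p hK]; trivial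
  choose κ hκ using h
  refine ⟨∑ s, κ s, fun Ω h1 h2 χ hχ B hB => ?_⟩
  have hzero : ∀ s x, x ∉ tsupport χ → (algBasis n).coord s (χ x) = 0 := fun s x hx => by
    rw [image_eq_zero_of_notMem_tsupport hx, map_zero]
  have hsm : ∀ s, ContDiff ℝ ∞ fun x => (algBasis n).coord s (χ x) := fun s =>
    contDiff_linearMap_comp _ χ.contDiff
  have hcs : ∀ s, HasCompactSupport fun x => (algBasis n).coord s (χ x) := fun s =>
    χ.hasCompactSupport.mono' fun x hx => by
      by_contra h'
      exact hx (hzero s x h')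
  have hsub : ∀ s, tsupport (fun x => (algBasis n).coord s (χ x)) ⊆ K := fun s =>
    (closure_minimal (fun x hx => by
      by_contra h'
      exact hx (hzero s x h')) (isClosed_tsupport _)).trans hχ
  have hsum : χ = ∑ s, TestForm.ofConst _ (hsm s) (hcs s) (algBasis n s) := by
    ext1 x
    rw [sum_apply]
    exact ((algBasis n).sum_repr (χ x)).symm
  conv_lhs => rw [hsum]
  rw [map_sum, map_sum, Finset.mul_sum]
  refine (Finset.abs_sum_le_sum_abs _ _).trans (Finset.sum_le_sum fun s _ => ?_)
  refine hκ s Ω h1 h2 _ _ _ (hsub s) B fun x => le_trans ?_ (hB x)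
  -- The norm on forms is the supremum of the coefficients, so each coefficient inherits the bound
  -- `B` without a constant.
  exact norm_le_pi_norm ((algBasis n).equivFun (χ x)) s

/-! ### Products of closed positive currents with `dd^#ψ`, for smooth convex `ψ` -/

theorem ddSharp_mem_symmetricForms {n : ℕ} {f : Space n → ℝ} (hf : ContDiff ℝ ∞ f)
    (hc : ConvexOn ℝ univ f) (x : Space n) : ddSharp f x ∈ symmetricForms n 1 := by
  obtain ⟨m, u, hu⟩ := exists_ddSharp_eq_sum hf hc x
  rw [hu]
  exact (symmetricSubmodule n 1).sum_mem fun i _ => xForm_mul_xiForm_mem_symmetricForms (u i)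

theorem ddSharp_mul_mem_stronglyPositive {n m : ℕ} {f : Space n → ℝ} (hf : ContDiff ℝ ∞ f)
    (hc : ConvexOn ℝ univ f) (x : Space n) {σ : Alg n} (hσ : σ ∈ stronglyPositive n m) :
    ddSharp f x * σ ∈ stronglyPositive n (m + 1) := by
  obtain ⟨N, u, hu⟩ := exists_ddSharp_eq_sum hf hc x
  rw [hu, Finset.sum_mul]
  exact Finset.sum_induction _ (· ∈ stronglyPositive n (m + 1))
    (fun _ _ => add_mem_stronglyPositive) (zero_mem_stronglyPositive n _)
    fun i _ => mul_mem_stronglyPositive (u i) hσ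

theorem ddSharp_mul_mem_weaklyNull {n m : ℕ} {f : Space n → ℝ} (hf : ContDiff ℝ ∞ f)
    (hc : ConvexOn ℝ univ f) (x : Space n) (hm : m + 1 ≤ n) {η : Alg n} (hη : η ∈ weaklyNull n m) :
    ddSharp f x * η ∈ weaklyNull n (m + 1) := by
  obtain ⟨N, u, hu⟩ := exists_ddSharp_eq_sum hf hc x
  rw [hu, Finset.sum_mul]
  exact Finset.sum_induction _ (· ∈ weaklyNull n (m + 1))
    (fun _ _ => add_mem_weaklyNull) (zero_mem_weaklyNull n _)
    fun i _ => mul_mem_weaklyNull hη hm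

theorem isClosedWeaklyPositiveStrong_wedgeCurrent {n p : ℕ} {Ω : Supercurrent n}
    (h : IsClosedWeaklyPositiveStrong p Ω) {f : Space n → ℝ} (hf : ContDiff ℝ ∞ f)
    (hc : ConvexOn ℝ univ f) :
    IsClosedWeaklyPositiveStrong (p + 1) (wedgeCurrent (ddSharp f) (contDiff_ddSharp hf) Ω) := by
  obtain ⟨hcl, ⟨⟨hbi, hsy⟩, hpos⟩, -, hnull⟩ := h
  have hS : IsSymmetricCurrent (p + 1) (wedgeCurrent (ddSharp f) (contDiff_ddSharp hf) Ω) := by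
    refine ⟨fun a b hab χ hχ => ?_, fun χ => ?_⟩
    · exact hbi (1 + a) (1 + b) (by omega) _ fun x =>
        mul_mem_bidegree (ddSharp_mem_symmetricForms hf hc x).1 (hχ x)
    · rw [wedgeCurrent_apply, wedgeCurrent_apply, ← hsy (TestForm.wedge _ _ χ)]
      congr 1
      ext1 x
      rw [TestForm.wedge_apply, TestForm.complexJ_apply, TestForm.complexJ_apply,
        TestForm.wedge_apply, map_mul, (ddSharp_mem_symmetricForms hf hc x).2]
  refine ⟨fun χ => ?_, ⟨hS, fun m hm χ hχ => ?_⟩, ⟨hS, fun m hm χ hχ => ?_⟩⟩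
  · rw [wedgeCurrent_apply, ← hcl (TestForm.wedge (ddSharp f) (contDiff_ddSharp hf) χ)]
    congr 1
    ext1 x
    exact (extD_ddSharp_mul hf χ.contDiff x).symm
  · exact hpos (m + 1) (by omega) _ fun x => ddSharp_mul_mem_stronglyPositive hf hc x (hχ x)
  · exact hnull (m + 1) (by omega) _ fun x => ddSharp_mul_mem_weaklyNull hf hc x (by omega) (hχ x)

/-! ### Weak limits -/

theorem tendsto_supercurrent_iff {n : ℕ} {ι : Type*} {l : Filter ι} {Ts : ι → Supercurrent n}
    {T : Supercurrent n} : Tendsto Ts l (𝓝 T) ↔ ∀ χ, Tendsto (fun i => Ts i χ) l (𝓝 (T χ)) :=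
  tendsto_iff_forall_eval_tendsto_topDualPairing

theorem isClosedWeaklyPositiveStrong_of_tendsto {n p : ℕ} {Ts : ℕ → Supercurrent n}
    {T : Supercurrent n} (h : ∀ i, IsClosedWeaklyPositiveStrong p (Ts i))
    (hT : ∀ χ, Tendsto (fun i => Ts i χ) atTop (𝓝 (T χ))) : IsClosedWeaklyPositiveStrong p T := by
  have hzero : ∀ χ, (∀ i, Ts i χ = 0) → T χ = 0 := fun χ h0 => by
    refine tendsto_nhds_unique (hT χ) ?_
    simp only [h0]
    exact tendsto_const_nhds
  have hS : IsSymmetricCurrent p T := by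
    refine ⟨fun a b hab χ hχ => hzero χ fun i => (h i).2.1.1.1 a b hab χ hχ, fun χ => ?_⟩
    refine tendsto_nhds_unique (hT χ.complexJ) ?_
    simp only [fun i => (h i).2.1.1.2 χ]
    exact hT χ
  exact ⟨fun χ => hzero _ fun i => (h i).1 χ,
    ⟨hS, fun m hm χ hχ => ge_of_tendsto' (hT χ) fun i => (h i).2.1.2 m hm χ hχ⟩,
    ⟨hS, fun m hm χ hχ => hzero χ fun i => (h i).2.2.2 m hm χ hχ⟩⟩

/-- The pointwise limit is linear. It is continuous because the mass bound passes to the limit and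
controls it by the sup norm on each compact set. -/
theorem exists_supercurrent_of_tendsto {n p : ℕ} {Ts : ℕ → Supercurrent n}
    (h : ∀ i, IsClosedWeaklyPositiveStrong p (Ts i))
    (hl : ∀ χ, ∃ l, Tendsto (fun i => Ts i χ) atTop (𝓝 l)) :
    ∃ T : Supercurrent n, ∀ χ, Tendsto (fun i => Ts i χ) atTop (𝓝 (T χ)) := by
  choose l hl using hl
  have hadd : ∀ χ η, l (χ + η) = l χ + l η := fun χ η =>
    tendsto_nhds_unique (hl _) (by simpa only [map_add] using (hl χ).add (hl η))
  have hsmul : ∀ (c : ℝ) χ, l (c • χ) = c • l χ := fun c χ =>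
    tendsto_nhds_unique (hl _) (by simpa only [map_smul] using (hl χ).const_smul c)
  refine ⟨StrongDual.toWeakDual (TestFunction.mkCLM ℝ l hadd hsmul fun K hK => ?_), hl⟩
  obtain ⟨κ, hκ⟩ := exists_isMassBound p K.isCompact
  refine (ContDiffMapSupportedIn.mkCLMtoNormedSpace ℝ (l ∘ TestFunction.ofSupportedIn hK)
    (fun f g => hadd (TestFunction.ofSupportedIn hK f) (TestFunction.ofSupportedIn hK g))
    (fun c f => hsmul c (TestFunction.ofSupportedIn hK f)) ⟨{0}, l κ, ?_, fun f => ?_⟩).continuous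
  · refine ge_of_tendsto' (hl κ) fun i => ?_
    -- The mass bound for the zero form with `B = 1` says that `κ` has nonnegative mass.
    have := hκ _ (h i).2.1 (h i).2.2 0 (by simp [tsupport]) 1 (by simp)
    simpa using this
  · rw [Finset.sup_singleton]
    have hb : ∀ i, |Ts i (TestFunction.ofSupportedIn hK f)| ≤
        ContDiffMapSupportedIn.seminorm ℝ (Space n) (Alg n) ⊤ K 0 f * Ts i κ := fun i =>
      hκ _ (h i).2.1 (h i).2.2 _ f.tsupport_subset _ fun x =>
        ContDiffMapSupportedIn.norm_apply_le_seminorm ℝ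
    rw [mul_comm]
    exact le_of_tendsto_of_tendsto' (hl _).abs ((hl κ).const_mul _) hb

/-! ### Smooth convex approximation -/

open MeasureTheory in
-- Convolution with a nonnegative bump averages translates of `f`, so it preserves convexity; a bump
-- supported within the scale of uniform continuity near `K` moves `f` by at most `ε` there.
theorem exists_contDiff_convexOn_dist_le {n : ℕ} {f : Space n → ℝ} (hf : ConvexOn ℝ univ f)
    {K : Set (Space n)} (hK : IsCompact K) {ε : ℝ} (hε : 0 < ε) :
    ∃ g : Space n → ℝ, ContDiff ℝ ∞ g ∧ ConvexOn ℝ univ g ∧ ∀ x ∈ K, |f x - g x| ≤ ε := by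
  have hcont : Continuous f := hf.locallyLipschitz.continuous
  have hu := hK.uniformContinuousAt_of_continuousAt f (fun a _ => hcont.continuousAt)
    (Metric.dist_mem_uniformity hε)
  obtain ⟨δ, hδ, hδu⟩ := Metric.mem_uniformity_dist.1 hu
  let φ : ContDiffBump (0 : Space n) := ⟨δ / 2, δ, half_pos hδ, half_lt_self hδ⟩
  have hex : ConvolutionExists (φ.normed volume) f (ContinuousLinearMap.lsmul ℝ ℝ) volume :=
    φ.hasCompactSupport_normed.convolutionExists_left _ φ.continuous_normed
      hcont.locallyIntegrable
  refine ⟨convolution (φ.normed volume) f (ContinuousLinearMap.lsmul ℝ ℝ) volume,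
    φ.hasCompactSupport_normed.contDiff_convolution_left _ φ.contDiff_normed
      hcont.locallyIntegrable, ⟨convex_univ, fun x _ y _ a b ha hb hab => ?_⟩, fun x hx => ?_⟩
  · simp only [convolution_def, ContinuousLinearMap.lsmul_apply, smul_eq_mul]
    have i1 : ∀ z, Integrable (fun t => φ.normed volume t * f (z - t)) volume := fun z => hex z
    rw [← integral_const_mul, ← integral_const_mul,
      ← integral_add ((i1 x).const_mul a) ((i1 y).const_mul b)]
    refine integral_mono (i1 _) (((i1 x).const_mul a).add ((i1 y).const_mul b)) fun t => ?_
    have h1 := hf.2 (mem_univ (x - t)) (mem_univ (y - t)) ha hb hab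
    have h2 : a • (x - t) + b • (y - t) = a • x + b • y - t := by
      rw [smul_sub, smul_sub, sub_add_sub_comm, ← add_smul, hab, one_smul]
    rw [h2, smul_eq_mul, smul_eq_mul] at h1
    have h3 := mul_le_mul_of_nonneg_left h1 (φ.nonneg_normed (μ := volume) t)
    refine h3.trans (le_of_eq ?_)
    ring
  · rw [abs_sub_comm, ← Real.dist_eq]
    refine φ.dist_normed_convolution_le hcont.aestronglyMeasurable fun y hy => ?_
    rw [dist_comm]
    exact (hδu (a := x) (b := y) (by rw [dist_comm]; exact hy) hx).le

/-! ### The product with `dd^#ψ`, for convex `ψ` -/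

theorem abs_apply_smulFun_sub_le {n p : ℕ} {Ω : Supercurrent n}
    (h : IsClosedWeaklyPositiveStrong p Ω) {K : Set (Space n)} {κ η : TestForm n}
    (hκ : IsMassBound p K κ) (hη : tsupport η ⊆ K) {B : ℝ} (hB : ∀ x, ‖η x‖ ≤ B)
    {f g : Space n → ℝ} (hf : ContDiff ℝ ∞ f) (hg : ContDiff ℝ ∞ g) {ε : ℝ} (hε : 0 ≤ ε)
    (hfg : ∀ x ∈ K, |f x - g x| ≤ ε) :
    |Ω (TestForm.smulFun f hf η) - Ω (TestForm.smulFun g hg η)| ≤ ε * B * Ω κ := by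
  have hB0 : 0 ≤ B := (norm_nonneg _).trans (hB 0)
  have happ : ∀ x, (TestForm.smulFun f hf η - TestForm.smulFun g hg η) x = (f x - g x) • η x :=
    fun x => by
      rw [sub_apply, TestForm.smulFun_apply, TestForm.smulFun_apply, sub_smul]
  rw [← map_sub]
  refine hκ Ω h.2.1 h.2.2 _ ((closure_minimal (fun x hx => ?_) (isClosed_tsupport η)).trans hη) _
    fun x => ?_
  · by_contra h'
    exact hx (by rw [happ, image_eq_zero_of_notMem_tsupport h', smul_zero])
  · rw [happ, norm_smul, Real.norm_eq_abs]
    by_cases hx : x ∈ K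
    · exact mul_le_mul (hfg x hx) (hB x) (norm_nonneg _) hε
    · rw [image_eq_zero_of_notMem_tsupport fun h' => hx (hη h'), norm_zero, mul_zero]
      exact mul_nonneg hε hB0

/-- `T` is the product `dd^#ψ ∧ Ω`, in the sense that `∫ T ∧ χ = -∫ ψ Ω ∧ d^#dχ`: the right side is
approximated by replacing `ψ` by smooth functions that are uniformly close to it. -/
def IsConvexWedge {n : ℕ} (p : ℕ) (ψ : Space n → ℝ) (Ω T : Supercurrent n) : Prop :=
  IsClosedWeaklyPositiveStrong (p + 1) T ∧
    ∀ (K : Set (Space n)) (χ κ : TestForm n) (B ε : ℝ) (g : Space n → ℝ) (hg : ContDiff ℝ ∞ g),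
      IsCompact K → IsMassBound p K κ → tsupport χ ⊆ K → (∀ x, ‖χ.d.dSharp x‖ ≤ B) → 0 ≤ ε →
      (∀ x ∈ K, |ψ x - g x| ≤ ε) →
        |T χ + Ω (TestForm.smulFun g hg χ.d.dSharp)| ≤ ε * B * Ω κ

theorem TestForm.tsupport_dSharp_d_subset {n : ℕ} (χ : TestForm n) :
    tsupport χ.d.dSharp ⊆ tsupport χ :=
  χ.d.tsupport_dSharp_subset.trans χ.tsupport_d_subset

theorem TestForm.exists_bound {n : ℕ} (χ : TestForm n) : ∃ B : ℝ, ∀ x, ‖χ x‖ ≤ B :=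
  χ.hasCompactSupport.exists_bound_of_continuous χ.continuous

/-- `T` is the limit of the products with smooth convex functions `g i` that are `1 / (i + 1)`-close
to `ψ` on the ball of radius `i`. -/
theorem exists_isConvexWedge {n p : ℕ} {Ω : Supercurrent n} (h : IsClosedWeaklyPositiveStrong p Ω)
    {ψ : Space n → ℝ} (hψ : ConvexOn ℝ univ ψ) : ∃ T, IsConvexWedge p ψ Ω T := by
  choose g hg hgc hgψ using fun i : ℕ => exists_contDiff_convexOn_dist_le hψ
    (isCompact_closedBall (0 : Space n) i) (Nat.one_div_pos_of_nat (α := ℝ) (n := i))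
  set Ts : ℕ → Supercurrent n := fun i => wedgeCurrent (ddSharp (g i)) (contDiff_ddSharp (hg i)) Ω
  have hTs : ∀ i, IsClosedWeaklyPositiveStrong (p + 1) (Ts i) := fun i =>
    isClosedWeaklyPositiveStrong_wedgeCurrent h (hg i) (hgc i)
  have hT : ∀ i χ, Ts i χ = -Ω (TestForm.smulFun (g i) (hg i) χ.d.dSharp) := fun i χ =>
    apply_wedge_ddSharp h.1 h.2.1.1 (hg i) χ
  have hev : ∀ K : Set (Space n), IsCompact K → ∃ N : ℕ, ∀ i ≥ N, ∀ x ∈ K,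
      |ψ x - g i x| ≤ 1 / ((i : ℝ) + 1) := by
    intro K hK
    obtain ⟨R, hR⟩ := hK.isBounded.subset_closedBall (0 : Space n)
    obtain ⟨N, hN⟩ := exists_nat_ge R
    exact ⟨N, fun i hi x hx => hgψ i x (Metric.closedBall_subset_closedBall
      (hN.trans (Nat.cast_le.2 hi)) (hR hx))⟩
  have hlim : ∀ C : ℝ, Tendsto (fun i : ℕ => 1 / ((i : ℝ) + 1) * C) atTop (𝓝 0) := fun C => by
    simpa using tendsto_one_div_add_atTop_nhds_zero_nat.mul_const C
  have hpos : ∀ i : ℕ, 0 ≤ 1 / ((i : ℝ) + 1) := fun i => Nat.one_div_pos_of_nat.le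
  have hconv : ∀ χ, ∃ l, Tendsto (fun i => Ts i χ) atTop (𝓝 l) := by
    intro χ
    obtain ⟨κ, hκ⟩ := exists_isMassBound p χ.hasCompactSupport.isCompact
    obtain ⟨B, hB⟩ := χ.d.dSharp.exists_bound
    obtain ⟨N, hN⟩ := hev _ χ.hasCompactSupport.isCompact
    refine cauchySeq_tendsto_of_complete (Metric.cauchySeq_iff'.2 fun ε hε => ?_)
    obtain ⟨m, hm, hmN⟩ := (((tendsto_order.1 (hlim (2 * B * Ω κ))).2 ε hε).and
      (eventually_ge_atTop N)).exists
    refine ⟨m, fun i hi => lt_of_le_of_lt ?_ hm⟩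
    -- For `i ≥ m`, both `g m` and `g i` lie within `1 / (m + 1)` of `ψ` on the support of `χ`,
    -- hence the factor `2`.
    have h1 := abs_apply_smulFun_sub_le h hκ χ.tsupport_dSharp_d_subset hB (hg m) (hg i)
      (mul_nonneg zero_le_two (hpos m)) fun x hx => by
        have h2 := abs_add_le (g m x - ψ x) (ψ x - g i x)
        rw [sub_add_sub_cancel, abs_sub_comm (g m x) (ψ x)] at h2
        have h3 : 1 / ((i : ℝ) + 1) ≤ 1 / ((m : ℝ) + 1) :=
          one_div_le_one_div_of_le (by positivity) (by exact_mod_cast Nat.succ_le_succ hi)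
        linarith [hN m hmN x hx, hN i (hmN.trans hi) x hx]
    rw [Real.dist_eq, hT, hT, neg_sub_neg]
    refine h1.trans (le_of_eq ?_)
    ring
  obtain ⟨T, hT'⟩ := exists_supercurrent_of_tendsto hTs hconv
  refine ⟨T, isClosedWeaklyPositiveStrong_of_tendsto hTs hT', ?_⟩
  intro K χ κ B ε f hf hK hκ hχ hB hε hψf
  obtain ⟨N, hN⟩ := hev K hK
  have h1 : Tendsto (fun i => |Ts i χ + Ω (TestForm.smulFun f hf χ.d.dSharp)|) atTop
      (𝓝 |T χ + Ω (TestForm.smulFun f hf χ.d.dSharp)|) := ((hT' χ).add_const _).abs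
  have h2 : Tendsto (fun i : ℕ => ε * B * Ω κ + 1 / ((i : ℝ) + 1) * (B * Ω κ)) atTop
      (𝓝 (ε * B * Ω κ)) := by
    simpa using (hlim (B * Ω κ)).const_add (ε * B * Ω κ)
  refine le_of_tendsto_of_tendsto h1 h2 ((eventually_ge_atTop N).mono fun i hi => ?_)
  -- On `K` the functions `f` and `g i` differ by at most `ε + 1 / (i + 1)`; the second term
  -- disappears in the limit.
  have h3 := abs_apply_smulFun_sub_le h hκ (χ.tsupport_dSharp_d_subset.trans hχ) hB hf (hg i)
    (add_nonneg hε (hpos i)) fun x hx => by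
      have := abs_add_le (f x - ψ x) (ψ x - g i x)
      rw [sub_add_sub_cancel, abs_sub_comm (f x) (ψ x)] at this
      exact this.trans (add_le_add (hψf x hx) (hN i hi x hx))
  simp only [hT]
  rw [neg_add_eq_sub]
  refine h3.trans (le_of_eq ?_)
  ring

/-- For smooth `ψ` the defining estimate may be used with `g = ψ` and `ε = 0`, which leaves the
integration by parts formula. -/
theorem IsConvexWedge.apply_eq {n p : ℕ} {Ω T : Supercurrent n} {ψ : Space n → ℝ}
    (hT : IsConvexWedge p ψ Ω T) (h : IsClosedWeaklyPositiveStrong p Ω) (hψ : ContDiff ℝ ∞ ψ) :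
    T = wedgeCurrent (ddSharp ψ) (contDiff_ddSharp hψ) Ω := by
  refine DFunLike.ext _ _ fun χ => ?_
  obtain ⟨κ, hκ⟩ := exists_isMassBound p χ.hasCompactSupport.isCompact
  obtain ⟨B, hB⟩ := χ.d.dSharp.exists_bound
  have h1 := hT.2 _ χ κ B 0 ψ hψ χ.hasCompactSupport.isCompact hκ subset_rfl hB le_rfl
    fun x _ => by rw [sub_self, abs_zero]
  rw [zero_mul, zero_mul, abs_nonpos_iff] at h1
  rw [wedgeCurrent_apply, apply_wedge_ddSharp h.1 h.2.1.1 hψ]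
  linarith

/-- One smooth `g` close to `ψ` is also close to `ψs i` for large `i`. Replacing both functions by
`g` costs an error uniform in `i`, since the masses `Ωs i κ` converge, and for fixed `g` only weak*
convergence of `Ωs` is needed. -/
theorem IsConvexWedge.tendsto {n p : ℕ} {Ωs Ts : ℕ → Supercurrent n} {Ω T : Supercurrent n}
    {ψs : ℕ → Space n → ℝ} {ψ : Space n → ℝ} (hTs : ∀ i, IsConvexWedge p (ψs i) (Ωs i) (Ts i))
    (hT : IsConvexWedge p ψ Ω T) (hψ : ConvexOn ℝ univ ψ)
    (hψs : TendstoLocallyUniformly ψs ψ atTop) (hΩs : Tendsto Ωs atTop (𝓝 Ω)) :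
    Tendsto Ts atTop (𝓝 T) := by
  rw [tendsto_supercurrent_iff] at hΩs ⊢
  intro χ
  have hK := χ.hasCompactSupport.isCompact
  obtain ⟨κ, hκ⟩ := exists_isMassBound p hK
  obtain ⟨B, hB⟩ := χ.d.dSharp.exists_bound
  have hB0 : 0 ≤ B := (norm_nonneg _).trans (hB 0)
  rw [Metric.tendsto_atTop']
  intro ε hε
  set C : ℝ := B * (|Ω κ| + 1) with hC
  have hC0 : 0 ≤ C := mul_nonneg hB0 (by positivity)
  -- The error budget is `2δC` for replacing `ψs i` by `g`, `δC` for replacing `ψ` by `g`, and `δ`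
  -- for replacing `Ωs i` by `Ω`.
  obtain ⟨δ, hδ, hδC⟩ : ∃ δ : ℝ, 0 < δ ∧ δ * (3 * C + 1) < ε :=
    ⟨ε / (2 * (3 * C + 1)), by positivity, by
      rw [div_mul_eq_mul_div, div_lt_iff₀ (by positivity)]; nlinarith⟩
  obtain ⟨g, hg, -, hψg⟩ := exists_contDiff_convexOn_dist_le hψ hK hδ
  have e1 : ∀ᶠ i in atTop, ∀ x ∈ tsupport χ, dist (ψ x) (ψs i x) < δ :=
    Metric.tendstoUniformlyOn_iff.1
      ((tendstoLocallyUniformlyOn_iff_tendstoUniformlyOn_of_compact hK).1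
        hψs.tendstoLocallyUniformlyOn) δ hδ
  have e2 : ∀ᶠ i in atTop, dist (Ωs i (TestForm.smulFun g hg χ.d.dSharp))
      (Ω (TestForm.smulFun g hg χ.d.dSharp)) < δ := Metric.tendsto_nhds.1 (hΩs _) δ hδ
  have e3 : ∀ᶠ i in atTop, dist (Ωs i κ) (Ω κ) < 1 := Metric.tendsto_nhds.1 (hΩs κ) 1 one_pos
  obtain ⟨N, hN⟩ := eventually_atTop.1 (e1.and (e2.and e3))
  refine ⟨N, fun i hi => ?_⟩
  obtain ⟨h1, h2, h3⟩ := hN i hi.le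
  have f1 := (hTs i).2 _ χ κ B (2 * δ) g hg hK hκ subset_rfl hB (by positivity) fun x hx => by
    have := abs_add_le (ψs i x - ψ x) (ψ x - g x)
    rw [sub_add_sub_cancel, abs_sub_comm (ψs i x) (ψ x), ← Real.dist_eq (ψ x) (ψs i x)] at this
    linarith [h1 x hx, hψg x hx]
  have f2 := hT.2 _ χ κ B δ g hg hK hκ subset_rfl hB hδ.le hψg
  rw [Real.dist_eq] at h2 h3 ⊢
  have f3 : 2 * δ * B * Ωs i κ ≤ 2 * δ * C := by
    rw [hC, mul_assoc]
    exact mul_le_mul_of_nonneg_left (mul_le_mul_of_nonneg_left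
      (by linarith [(abs_lt.1 h3).2, le_abs_self (Ω κ)]) hB0) (by positivity)
  have f4 : δ * B * Ω κ ≤ δ * C := by
    rw [hC, mul_assoc]
    exact mul_le_mul_of_nonneg_left (mul_le_mul_of_nonneg_left
      (by linarith [le_abs_self (Ω κ)]) hB0) hδ.le
  rw [abs_le] at f1 f2
  rw [abs_lt] at h2 ⊢
  constructor <;> nlinarith

open Classical in
/-- The current `dd^#ψ ∧ Ω`, for convex `ψ` and a closed weakly positive strong `(p, p)`-current
`Ω`. -/
noncomputable def convexWedge {n : ℕ} (p : ℕ) (ψ : Space n → ℝ) (Ω : Supercurrent n) :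
    Supercurrent n :=
  if h : ∃ T, IsConvexWedge p ψ Ω T then h.choose else 0

theorem isConvexWedge_convexWedge {n p : ℕ} {Ω : Supercurrent n}
    (h : IsClosedWeaklyPositiveStrong p Ω) {ψ : Space n → ℝ} (hψ : ConvexOn ℝ univ ψ) :
    IsConvexWedge p ψ Ω (convexWedge p ψ Ω) := by
  have hex := exists_isConvexWedge h hψ
  rw [convexWedge, dif_pos hex]
  exact hex.choose_spec

/-- The current `dd^#ψ₁ ∧ … ∧ dd^#ψ_k ∧ Ω`, for convex `ψ₁, …, ψ_k` and a closed weakly positive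
strong `(p, p)`-current `Ω`. -/
noncomputable def iteratedConvexWedge {n : ℕ} : (k p : ℕ) → (Fin k → Space n → ℝ) →
    Supercurrent n → Supercurrent n
  | 0, _, _, Ω => Ω
  | k + 1, p, ψ, Ω => iteratedConvexWedge k (p + 1) (fun j => ψ j.succ) (convexWedge p (ψ 0) Ω)

theorem isClosedWeaklyPositiveStrong_iteratedConvexWedge {n k p : ℕ} {Ω : Supercurrent n}
    (h : IsClosedWeaklyPositiveStrong p Ω) {ψ : Fin k → Space n → ℝ}
    (hψ : ∀ j, ConvexOn ℝ univ (ψ j)) :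
    IsClosedWeaklyPositiveStrong (p + k) (iteratedConvexWedge k p ψ Ω) := by
  induction k generalizing p Ω with
  | zero => exact h
  | succ k ih =>
    have := ih (isConvexWedge_convexWedge h (hψ 0)).1 fun j => hψ j.succ
    rw [add_assoc, add_comm 1 k] at this
    exact this

theorem iteratedConvexWedge_of_contDiff {n k p : ℕ} {Ω : Supercurrent n}
    (h : IsClosedWeaklyPositiveStrong p Ω) {ψ : Fin k → Space n → ℝ}
    (hψ : ∀ j, ConvexOn ℝ univ (ψ j)) (hs : ∀ j, ContDiff ℝ ∞ (ψ j)) :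
    iteratedConvexWedge k p ψ Ω = wedgeCurrent (ddSharpWedge ψ) (contDiff_ddSharpWedge hs) Ω := by
  induction k generalizing p Ω with
  | zero =>
    refine DFunLike.ext _ _ fun χ => ?_
    rw [wedgeCurrent_apply]
    refine congrArg Ω ?_
    ext1 x
    simp [TestForm.wedge_apply, ddSharpWedge]
  | succ k ih =>
    have h1 := isConvexWedge_convexWedge h (hψ 0)
    refine (ih h1.1 (fun j => hψ j.succ) fun j => hs j.succ).trans ?_
    rw [h1.apply_eq h (hs 0)]
    refine DFunLike.ext _ _ fun χ => ?_
    -- The recursion applies `ψ 0` to `Ω` first, so on the test form side `dd^#ψ₀` stands leftmost,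
    -- as in `ddSharpWedge`; associativity suffices.
    simp only [wedgeCurrent_apply]
    congr 1
    ext1 x
    simp [TestForm.wedge_apply, ddSharpWedge, List.ofFn_succ, mul_assoc]

theorem tendsto_iteratedConvexWedge {n k p : ℕ} {Ωs : ℕ → Supercurrent n} {Ω : Supercurrent n}
    {ψs : ℕ → Fin k → Space n → ℝ} {ψ : Fin k → Space n → ℝ}
    (hψs : ∀ i j, ConvexOn ℝ univ (ψs i j)) (hψ : ∀ j, ConvexOn ℝ univ (ψ j))
    (hΩs : ∀ i, IsClosedWeaklyPositiveStrong p (Ωs i)) (hΩ : IsClosedWeaklyPositiveStrong p Ω)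
    (hlim : ∀ j, TendstoLocallyUniformly (fun i => ψs i j) (ψ j) atTop)
    (hΩlim : Tendsto Ωs atTop (𝓝 Ω)) :
    Tendsto (fun i => iteratedConvexWedge k p (ψs i) (Ωs i)) atTop
      (𝓝 (iteratedConvexWedge k p ψ Ω)) := by
  induction k generalizing p Ω Ωs with
  | zero => exact hΩlim
  | succ k ih =>
    have h1 := fun i => isConvexWedge_convexWedge (hΩs i) (hψs i 0)
    have h2 := isConvexWedge_convexWedge hΩ (hψ 0)
    exact ih (fun i j => hψs i j.succ) (fun j => hψ j.succ) (fun i => (h1 i).1) h2.1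
      (fun j => hlim j.succ) (IsConvexWedge.tendsto h1 h2 (hψ 0) (hlim 0) hΩlim)

end Superform

theorem mainTheorem6 (n p k : ℕ) :
    ∃ M : (Fin k → Space n → ℝ) → Supercurrent n → Supercurrent n,
      -- on smooth functions, `M` is the wedge product
      (∀ (ψ : Fin k → Space n → ℝ) (hψ : ∀ j, ContDiff ℝ ∞ (ψ j)) (Ω : Supercurrent n),
        HasBidegree p p Ω → ∀ χ : TestForm n,
          M ψ Ω χ = Ω (TestForm.wedge (ddSharpWedge ψ) (contDiff_ddSharpWedge hψ) χ)) ∧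
      -- `M` is continuous
      (∀ (ψs : ℕ → Fin k → Space n → ℝ) (ψ : Fin k → Space n → ℝ)
          (Ωs : ℕ → Supercurrent n) (Ω : Supercurrent n),
        (∀ i j, ConvexOn ℝ Set.univ (ψs i j)) → (∀ j, ConvexOn ℝ Set.univ (ψ j)) →
        (∀ i, IsClosedWeaklyPositiveStrong p (Ωs i)) → IsClosedWeaklyPositiveStrong p Ω →
        (∀ j, TendstoLocallyUniformly (fun i => ψs i j) (ψ j) Filter.atTop) →
        Filter.Tendsto Ωs Filter.atTop (nhds Ω) →
        Filter.Tendsto (fun i => M (ψs i) (Ωs i)) Filter.atTop (nhds (M ψ Ω))) ∧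
      -- `M` preserves the class of closed, weakly positive, strong currents
      (∀ (ψ : Fin k → Space n → ℝ) (Ω : Supercurrent n),
        (∀ j, ConvexOn ℝ Set.univ (ψ j)) → IsClosedWeaklyPositiveStrong p Ω →
        IsClosedWeaklyPositiveStrong (p + k) (M ψ Ω)) := by
  classical
  -- For smooth `ψ` the literal product is required even without convexity, hence the case
  -- distinction. `hMeq` shows that both branches agree when the `ψ j` are convex and `Ω` is in the
  -- admissible class; the value of the second branch outside these hypotheses is irrelevant.
  set M : (Fin k → Space n → ℝ) → Supercurrent n → Supercurrent n := fun ψ Ω =>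
    if h : ∀ j, ContDiff ℝ ∞ (ψ j) then wedgeCurrent (ddSharpWedge ψ) (contDiff_ddSharpWedge h) Ω
    else iteratedConvexWedge k p ψ Ω with hM
  have hMeq : ∀ ψ Ω, (∀ j, ConvexOn ℝ Set.univ (ψ j)) → IsClosedWeaklyPositiveStrong p Ω →
      M ψ Ω = iteratedConvexWedge k p ψ Ω := by
    intro ψ Ω hψ hΩ
    by_cases h : ∀ j, ContDiff ℝ ∞ (ψ j)
    · rw [hM, iteratedConvexWedge_of_contDiff hΩ hψ h]
      exact dif_pos h
    · exact dif_neg h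
  refine ⟨M, fun ψ hψ Ω _ χ => ?_, fun ψs ψ Ωs Ω hψs hψ hΩs hΩ hlim hΩlim => ?_,
    fun ψ Ω hψ hΩ => ?_⟩
  · have : M ψ Ω = wedgeCurrent (ddSharpWedge ψ) (contDiff_ddSharpWedge hψ) Ω := dif_pos hψ
    rw [this, wedgeCurrent_apply]
  · rw [hMeq ψ Ω hψ hΩ, funext fun i => hMeq (ψs i) (Ωs i) (hψs i) (hΩs i)]
    exact tendsto_iteratedConvexWedge hψs hψ hΩs hΩ hlim hΩlim
  · rw [hMeq ψ Ω hψ hΩ]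
    exact isClosedWeaklyPositiveStrong_iteratedConvexWedge hΩ hψ
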